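/- **Setting.** A dilatation structure $(X,d,\delta)$ consists of a complete metric space $(X,d)$ whose closed balls $\bar B(x,3)$ are compact and, for every $x\in X$, of homeomorphisms $\delta^x_\varepsilon:U(x)\to V_\varepsilon(x)$ for $0<\varepsilon\le 1$ and $\delta^x_\varepsilon:W_\varepsilon(x)\to U(x)$ for $\varepsilon>1$, such that: * (A0) there are $1<A<B$ such that for all $x$ and all $\varepsilon\in(0,1)$: $\bar B(x,A)\subset U(x)$ and $B(x,\varepsilon)\subset\delta^x_\varepsilon B(x,A)\subset V_\varepsilon(x)\subset W_{\varepsilon^{-1}}(x)\subset\delta^x_\varepsilon (B(x,B)\cap U(x))$; and for every compact $K$ there are $R>0$, $\varepsilon_0\in(0,1)$ with $\delta^x_\varepsilon v\in W_{\varepsilon^{-1}}(\delta^x_\varepsilon u)$ for all $x\in K$, $u,v\in\bar B(x,R)$, $\varepsilon\in(0,\varepsilon_0)$; * (A1) $\delta^x_\varepsilon x=x$, $\delta^x_1=\mathrm{id}$, and $(\varepsilon,x,y)\mapsto\delta^x_\varepsilon y$ is continuous on its domain and extends continuously to the closure of the domain in $[0,\infty)\times X\times X$, with value $x$ at $(0,x,y)$;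 * (A2) for $u\in U(x)$, $\delta^x_\varepsilon\delta^x_\mu u=\delta^x_{\varepsilon\mu}u$ whenever the left-hand side is defined (the right-hand side then being defined too), and, if $\mu\le1$, also whenever the right-hand side is defined; * (A3) for every $x$ there is a distance $d^x$ on $\bar B(x,A)$ such that $\frac1\varepsilon d(\delta^x_\varepsilon u,\delta^x_\varepsilon v)\to d^x(u,v)$ as $\varepsilon\to0$, uniformly in $u,v\in\bar B(x,A)$ and in $x$ in compact sets. It is *strong* if moreover (A4) $\delta^{\delta^x_\varepsilon u}_{\varepsilon^{-1}}\delta^x_\varepsilon v$ converges as $\varepsilon\to0$, uniformly for $x$ in compact sets and $u,v$ sufficiently close to $x$. For a strong dilatation structure let $\Sigma^x(u,v)=\lim_{\varepsilon\to0}\delta^x_{\varepsilon^{-1}}\delta_\varepsilon^{\delta^x_\varepsilon u}v$ for $u,v$ close to $x$. The tangent space $T_xX=T_x(X,\delta,d)$ is a neighbourhood of $x$ with the local group operation $\Sigma^x$ (neutral element $x$), the dilatations $\delta^x_\varepsilon$ and the distance $d^x$. $D(T_xX)$ is the set of $u$ for which $a\in((0,\infty),+)\mapsto\delta^x_au$ is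 a morphism, i.e. $\Sigma^x(\delta^x_au,\delta^x_bu)=\delta^x_{a+b}u$ for all $a,b>0$; since $T_xX$ is only a local group, this is read after applying $\delta^x_s$ with $s>0$ small enough: $\Sigma^x(\delta^x_{sa}u,\delta^x_{sb}u)=\delta^x_{s(a+b)}u$. A curve $c$ is derivable at $t$ if there is a conical group morphism $f$ from a neighbourhood $(-r,r)$ of $0$ in $\mathbb R$ to $T_{c(t)}X$ (that is, $f(h+k)=\Sigma^{c(t)}(f(h),f(k))$ and $f(\lambda h)=\delta^{c(t)}_\lambda f(h)$ for $\lambda>0$, whenever $h,k,h+k,\lambda h\in(-r,r)$) such that $\sup_{|h|<r}\frac1\varepsilon d(c(t+\varepsilon h),\delta^{c(t)}_\varepsilon f(h))\to0$ as $\varepsilon\to0^+$. The structure has the Radon–Nikodym property (RNP) if every Lipschitz curve $c:[a,b]\to(X,d)$ is derivable at almost every $t$. $(X,d)$ is a length space if any two points are joined by Lipschitz curves and $d(x,y)$ is the infimum of the lengths of the Lipschitz curves from $x$ to $y$. Two strong dilatation structures $(X,d,\delta)$ and $(X,\bar d,\bar\delta)$ on the same set are *equivalent* if the identity $(X,d)\to(X,\bar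 d)$ is bilipschitz and for every $x$ there are functions $P^x,Q^x$, defined for $u$ sufficiently close to $x$, with $$\lim_{\varepsilon\to0}\tfrac1\varepsilon\bar d(\delta^x_\varepsilon u,\bar\delta^x_\varepsilon Q^x(u))=0,\qquad \lim_{\varepsilon\to0}\tfrac1\varepsilon d(\bar\delta^x_\varepsilon u,\delta^x_\varepsilon P^x(u))=0,$$ uniformly for $x,u$ in compact sets. **Statement.** Let $(X,d,\delta)$ and $(X,\bar d,\bar\delta)$ be equivalent strong dilatation structures, with functions $P^x,Q^x$ as above. 1. For every $x\in X$, $Q^x(D(T_x(X,\delta,d)))=D(T_x(X,\bar\delta,\bar d))$ near $x$: for every sufficiently small neighbourhood $N$ of $x$, $Q^x(N)$ is a neighbourhood of $x$ and $Q^x(D(T_x(X,\delta,d))\cap N)=D(T_x(X,\bar\delta,\bar d))\cap Q^x(N)$. 2. If $(X,d,\delta)$ has the Radon–Nikodym property, then so does $(X,\bar d,\bar\delta)$. 3. Suppose that $(X,d)$ and $(X,\bar d)$ are (complete) length spaces, that both structures have the Radon–Nikodym property, and that for every $x$ the maps $Q^x$ and $P^x$ are isometries near $x$ between $d^x$ and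 $\bar d^x$, i.e. $\bar d^x(Q^x(u),Q^x(v))=d^x(u,v)$ and $d^x(P^x(u),P^x(v))=\bar d^x(u,v)$ for $u,v$ sufficiently close to $x$. Then $d=\bar d$. -/

import Mathlib

open Set Filter Topology

/-- A dilatation structure `(X, d, δ)`. The distance `d` is that of the bundled `MetricSpace X`.
`δ ε x` is the dilatation of coefficient `ε > 0` based at `x`; only its restriction to
`U x` (if `ε ≤ 1`) or to `W ε x` (if `ε > 1`) is meaningful, its values elsewhere are junk.
The constants `A` and `B` and the distances `tdist x` (meaningful on the closed ball of radius `A`,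
where they are determined by `d` and `δ`) are those whose existence the axioms require. -/
structure DilatationStructure (X : Type*) extends MetricSpace X where
  /-- the dilatations -/
  δ : ℝ → X → X → X
  /-- the domain of `δ ε x` for `ε ≤ 1` -/
  U : X → Set X
  /-- the image of `δ ε x` for `ε ≤ 1` -/
  V : ℝ → X → Set X
  /-- the domain of `δ ε x` for `ε > 1` -/
  W : ℝ → X → Set X
  A : ℝ
  B : ℝ
  /-- the tangent distance `d^x` -/
  tdist : X → X → X → ℝ
  /-- `X` is complete -/
  complete : CompleteSpace X
  /-- closed balls of radius 3 are compact -/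
  compact_closedBall : ∀ x : X, IsCompact (Metric.closedBall x 3)
  /-- for `ε ≤ 1`, `δ ε x : U x → V ε x` is a homeomorphism -/
  homeo_le : ∀ (x : X) (ε : ℝ), 0 < ε → ε ≤ 1 →
    IsEmbedding ((U x).domRestrict (δ ε x)) ∧ δ ε x '' U x = V ε x
  /-- for `ε > 1`, `δ ε x : W ε x → U x` is a homeomorphism -/
  homeo_gt : ∀ (x : X) (ε : ℝ), 1 < ε →
    IsEmbedding ((W ε x).domRestrict (δ ε x)) ∧ δ ε x '' W ε x = U x
  /-- A0: the constants -/
  one_lt_A : 1 < A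
  A_lt_B : A < B
  /-- A0 and A3 apply the dilatations to the balls of radius `A` -/
  closedBall_subset : ∀ x : X, Metric.closedBall x A ⊆ U x
  /-- A0: the string of inclusions -/
  inclusions : ∀ (x : X) (ε : ℝ), 0 < ε → ε < 1 →
    Metric.ball x ε ⊆ δ ε x '' Metric.ball x A ∧
    δ ε x '' Metric.ball x A ⊆ V ε x ∧
    V ε x ⊆ W ε⁻¹ x ∧
    W ε⁻¹ x ⊆ δ ε x '' (Metric.ball x B ∩ U x)
  /-- A0: the technical condition on domains -/
  mem_W : ∀ K : Set X, IsCompact K → ∃ R > 0, ∃ ε₀ : ℝ, 0 < ε₀ ∧ ε₀ < 1 ∧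
    ∀ x ∈ K, ∀ u ∈ Metric.closedBall x R, ∀ v ∈ Metric.closedBall x R,
      ∀ ε : ℝ, 0 < ε → ε < ε₀ → δ ε x v ∈ W ε⁻¹ (δ ε x u)
  /-- A1: the base point is fixed -/
  δ_self : ∀ (x : X) (ε : ℝ), 0 < ε → δ ε x x = x
  /-- A1: the dilatation of coefficient one is the identity -/
  δ_one : ∀ (x : X), ∀ u ∈ U x, δ 1 x u = u
  /-- A1: `δ` is continuous on its domain and extends continuously to the closure of the domain,
  with value `x` at `(0, x, y)` -/
  continuous_ext : ∃ E : ℝ × X × X → X,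
    ContinuousOn E (closure {p : ℝ × X × X | 0 < p.1 ∧
      ((p.1 ≤ 1 ∧ p.2.2 ∈ U p.2.1) ∨ (1 < p.1 ∧ p.2.2 ∈ W p.1 p.2.1))}) ∧
    (∀ (ε : ℝ) (x y : X), 0 < ε → ((ε ≤ 1 ∧ y ∈ U x) ∨ (1 < ε ∧ y ∈ W ε x)) →
      E (ε, x, y) = δ ε x y) ∧
    (∀ x y : X, ((0 : ℝ), x, y) ∈ closure {p : ℝ × X × X | 0 < p.1 ∧
      ((p.1 ≤ 1 ∧ p.2.2 ∈ U p.2.1) ∨ (1 < p.1 ∧ p.2.2 ∈ W p.1 p.2.1))} → E (0, x, y) = x)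
  /-- A2: `δ ε x (δ μ x u) = δ (ε * μ) x u` whenever the left hand side is defined -/
  δ_mul : ∀ (x : X) (ε μ : ℝ), 0 < ε → 0 < μ → ∀ u ∈ U x,
    ((μ ≤ 1 ∧ u ∈ U x) ∨ (1 < μ ∧ u ∈ W μ x)) →
    ((ε ≤ 1 ∧ δ μ x u ∈ U x) ∨ (1 < ε ∧ δ μ x u ∈ W ε x)) →
    ((ε * μ ≤ 1 ∧ u ∈ U x) ∨ (1 < ε * μ ∧ u ∈ W (ε * μ) x)) ∧
      δ ε x (δ μ x u) = δ (ε * μ) x u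
  /-- A2: for `μ ≤ 1` the left hand side is defined whenever the right hand side is -/
  δ_mul_dom : ∀ (x : X) (ε μ : ℝ), 0 < ε → 0 < μ → μ ≤ 1 → ∀ u ∈ U x,
    ((ε * μ ≤ 1 ∧ u ∈ U x) ∨ (1 < ε * μ ∧ u ∈ W (ε * μ) x)) →
    ((ε ≤ 1 ∧ δ μ x u ∈ U x) ∨ (1 < ε ∧ δ μ x u ∈ W ε x))
  /-- A3: `tdist x` is a distance on the closed ball of radius `A` -/
  tdist_eq_zero : ∀ x : X, ∀ u ∈ Metric.closedBall x A, ∀ v ∈ Metric.closedBall x A,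
    (tdist x u v = 0 ↔ u = v)
  tdist_nonneg : ∀ x : X, ∀ u ∈ Metric.closedBall x A, ∀ v ∈ Metric.closedBall x A,
    0 ≤ tdist x u v
  tdist_comm : ∀ x : X, ∀ u ∈ Metric.closedBall x A, ∀ v ∈ Metric.closedBall x A,
    tdist x u v = tdist x v u
  tdist_triangle : ∀ x : X, ∀ u ∈ Metric.closedBall x A, ∀ v ∈ Metric.closedBall x A,
    ∀ w ∈ Metric.closedBall x A, tdist x u w ≤ tdist x u v + tdist x v w
  /-- A3: the rescaled distances converge to `tdist x`, uniformly on the closed ball of radius `A`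
  and uniformly for `x` in compact sets -/
  tendsto_tdist : ∀ K : Set X, IsCompact K → ∀ η > 0, ∀ᶠ ε : ℝ in 𝓝[>] 0,
    ∀ x ∈ K, ∀ u ∈ Metric.closedBall x A, ∀ v ∈ Metric.closedBall x A,
      |dist (δ ε x u) (δ ε x v) / ε - tdist x u v| ≤ η

/-- A strong dilatation structure: a dilatation structure with axiom A4, that is, the approximate
differences `Δ^x_ε(u, v) = δ_{ε⁻¹}^{δ_ε^x u} δ_ε^x v` converge as `ε → 0`, uniformly for `x` in
compact sets and `u, v` sufficiently close to `x`. -/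
structure StrongDilatationStructure (X : Type*) extends DilatationStructure X where
  tendsto_difference : ∃ Δ : X → X → X → X, ∀ K : Set X, IsCompact K → ∃ R > 0,
    ∀ η > 0, ∀ᶠ ε : ℝ in 𝓝[>] 0, ∀ x ∈ K,
      ∀ u ∈ Metric.closedBall x R, ∀ v ∈ Metric.closedBall x R,
        dist (δ ε⁻¹ (δ ε x u) (δ ε x v)) (Δ x u v) ≤ η

namespace StrongDilatationStructure

variable {X : Type*}

/-- The domain of the dilatation `δ ε x`. -/
def dom (S : StrongDilatationStructure X) (ε : ℝ) (x : X) : Set X :=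
  {u | (ε ≤ 1 ∧ u ∈ S.U x) ∨ (1 < ε ∧ u ∈ S.W ε x)}

/-- `S.IsSum x u v w`: in the local group `T_x X`, the product `Σ^x(u, v)` is defined and equals
`w`. Here `Σ^x(u, v)` is the limit as `ε → 0` of `δ_{ε⁻¹}^x δ_ε^{δ_ε^x u} v`. -/
def IsSum (S : StrongDilatationStructure X) (x u v w : X) : Prop :=
  letI := S.toMetricSpace
  (∀ᶠ ε : ℝ in 𝓝[>] 0, u ∈ S.U x ∧ v ∈ S.U (S.δ ε x u) ∧
    S.δ ε (S.δ ε x u) v ∈ S.W ε⁻¹ x) ∧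
  Tendsto (fun ε : ℝ => S.δ ε⁻¹ x (S.δ ε (S.δ ε x u) v)) (𝓝[>] 0) (𝓝 w)

/-- The set `D(T_x X)` of those `u` for which `a ↦ δ_a u` is a morphism from `((0, ∞), +)` to the
conical group `T_x X`, that is, `Σ^x(δ_a u, δ_b u) = δ_{a + b} u` for all `a, b > 0`. As `T_x X` is
a local group, in which these points need not lie, the identity is read after applying the group
automorphisms `δ_s` with `s` small. -/
def horizontal (S : StrongDilatationStructure X) (x : X) : Set X :=
  {u | u ∈ S.U x ∧ ∀ a b : ℝ, 0 < a → 0 < b → ∀ᶠ s : ℝ in 𝓝[>] 0,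
    S.IsSum x (S.δ (s * a) x u) (S.δ (s * b) x u) (S.δ (s * (a + b)) x u)}

/-- The curve `c` is derivable at `t`: there is a conical group morphism `f` from `ℝ` to `T_{c t} X`
(defined on a neighbourhood of zero) such that
`sup {d(c(t + ε h), δ_ε^{c t} f(h)) / ε : |h| < r}` tends to zero as `ε → 0`. -/
def DerivableAt (S : StrongDilatationStructure X) (c : ℝ → X) (t : ℝ) : Prop :=
  ∃ r > 0, ∃ f : ℝ → X,
    (∀ h : ℝ, |h| < r → f h ∈ S.U (c t)) ∧
    (∀ h k : ℝ, |h| < r → |k| < r → |h + k| < r → S.IsSum (c t) (f h) (f k) (f (h + k))) ∧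
    (∀ l h : ℝ, 0 < l → |h| < r → |l * h| < r →
      f h ∈ S.dom l (c t) ∧ S.δ l (c t) (f h) = f (l * h)) ∧
    ∀ η > 0, ∀ᶠ ε : ℝ in 𝓝[>] 0, ∀ h : ℝ, |h| < r →
      S.dist (c (t + ε * h)) (S.δ ε (c t) (f h)) / ε ≤ η

/-- The Radon-Nikodym property: any Lipschitz curve is derivable almost everywhere. -/
def RadonNikodym (S : StrongDilatationStructure X) : Prop :=
  letI := S.toMetricSpace
  ∀ (a b : ℝ) (c : ℝ → X) (C : NNReal), a < b → LipschitzOnWith C c (Icc a b) →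
    ∀ᵐ t : ℝ, t ∈ Ioo a b → S.DerivableAt c t

/-- `(X, d)` is a length space: `d(x, y)` is the infimum of the lengths of the Lipschitz curves
from `x` to `y`, and there are such curves (the infimum of the empty set being `∞`). -/
def IsLengthSpace (S : StrongDilatationStructure X) : Prop :=
  letI := S.toMetricSpace
  ∀ x y : X, IsGLB {l : ENNReal | ∃ (a b : ℝ) (c : ℝ → X) (C : NNReal), a ≤ b ∧
    LipschitzOnWith C c (Icc a b) ∧ c a = x ∧ c b = y ∧ l = eVariationOn c (Icc a b)} (edist x y)

/-- The functions `Q^x`, defined for `u` sufficiently close to `x`, satisfy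
`d̄(δ^x_ε u, δ̄^x_ε Q^x u) / ε → 0` as `ε → 0`, uniformly for `x` and `u` in compact sets. -/
def IsTransition (S T : StrongDilatationStructure X) (Q : X → X → X) : Prop :=
  letI := S.toMetricSpace
  ∀ K : Set X, IsCompact K → ∃ r > 0,
    (∀ x ∈ K, ∀ u ∈ K, S.dist x u ≤ r → u ∈ S.U x ∧ Q x u ∈ T.U x) ∧
    ∀ η > 0, ∀ᶠ ε : ℝ in 𝓝[>] 0, ∀ x ∈ K, ∀ u ∈ K, S.dist x u ≤ r →
      T.dist (S.δ ε x u) (T.δ ε x (Q x u)) / ε ≤ η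

/-- The two strong dilatation structures are equivalent, with transition functions `P` and `Q`. -/
structure EquivalentVia (S T : StrongDilatationStructure X) (P Q : X → X → X) : Prop where
  /-- the identity map is bilipschitz -/
  bilipschitz : ∃ k K : ℝ, 0 < k ∧ 0 < K ∧
    ∀ x y : X, k * S.dist x y ≤ T.dist x y ∧ T.dist x y ≤ K * S.dist x y
  transition_Q : IsTransition S T Q
  transition_P : IsTransition T S P

/-- Each `Q^x` is, near `x`, an isometry from `(T_x X, d^x)` to `(T̄_x X, d̄^x)`. -/
def TangentIsometry (S T : StrongDilatationStructure X) (Q : X → X → X) : Prop :=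
  ∀ x : X, ∃ r > 0, ∀ u v : X, S.dist x u ≤ r → S.dist x v ≤ r →
    T.tdist x (Q x u) (Q x v) = S.tdist x u v

end StrongDilatationStructure

/-!
The proof compares points at first order: `FirstOrderEq` says that two families satisfy
`d(p, q) = o(e)` as the scale `e` tends to zero. This relation is the same for two bilipschitz
distances, and it determines everything in sight.

Inside one strong dilatation structure, `eq_of_firstOrderEq` shows that dilatations separate points
to first order, and `exists_convTo_of_firstOrderEq` (compactness of balls, uniformity of the
convergence of the rescaled distances) that this holds continuously near the base point. The strong
axiom gives `exists_firstOrderEq_δ_base`: if `d(y, z) = o(e)`, then `δ_e^y v` and `δ_e^z v` agree to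
first order. Hence near `x` the identity `Σ^x(u, v) = w` is equivalent to the first order agreement
of `δ_ε^{δ_ε^x u} v` with `δ_ε^x w`.

The function `Q^x` is characterised by the first order agreement of `δ_ε^x u` with `δ̄_ε^x Q^x(u)`.
So `Q` commutes with dilatations, has inverse `P`, is jointly continuous in the base point and the
argument, and therefore, base points being interchangeable to first order, is a morphism of local
groups (`IsTransitionNear.exists_isSum`). It thus carries horizontal points to horizontal points
and derivatives of curves to derivatives of curves, which gives the first two assertions.

For the third, let `c` be a Lipschitz curve. Where `c` is derivable, its metric speeds for the two
distances are the tangent norms of the derivative, which agree as `Q^x` is an isometry. The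
derivative of `t ↦ d(c(s), c(t))` is therefore at most that of the `d̄`-arc length at almost every
`t`. Integrating, `d(c(s), c(t))` is at most the `d̄`-length of `c` between `s` and `t`, hence the
`d`-length of a curve is at most its `d̄`-length. In length spaces this gives `d ≤ d̄`, and equality
by symmetry.
-/

namespace StrongDilatationStructure

variable {X : Type*}

/-- The family `y` converges to `x` along `l`, for the distance of `S`. Stated through distances
rather than neighbourhoods, so that it compares directly between two bilipschitz structures. -/
def ConvTo {ι : Type*} (S : StrongDilatationStructure X) (l : Filter ι) (y : ι → X) (x : X) :
    Prop :=
  Tendsto (fun i => S.dist (y i) x) l (𝓝 0)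

/-- The families `p` and `q` agree to first order at the scale `e`: `d(p, q) = o(e)` along `l`. -/
def FirstOrderEq {ι : Type*} (S : StrongDilatationStructure X) (l : Filter ι) (e : ι → ℝ)
    (p q : ι → X) : Prop :=
  Tendsto (fun i => S.dist (p i) (q i) / e i) l (𝓝 0)

/-! ### Convergence and first order agreement -/

section Metric

variable (S : StrongDilatationStructure X) {ι : Type*} {l : Filter ι} {e : ι → ℝ}

theorem dist_self' (x : X) : S.dist x x = 0 :=
  let := S.toMetricSpace; dist_self x

theorem dist_comm' (x y : X) : S.dist x y = S.dist y x :=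
  let := S.toMetricSpace; dist_comm x y

theorem dist_triangle' (x y z : X) : S.dist x z ≤ S.dist x y + S.dist y z :=
  let := S.toMetricSpace; dist_triangle x y z

theorem dist_nonneg' (x y : X) : 0 ≤ S.dist x y :=
  let := S.toMetricSpace; dist_nonneg

theorem edist_eq_ofReal (x y : X) : S.edist x y = ENNReal.ofReal (S.dist x y) :=
  let := S.toMetricSpace; edist_dist x y

theorem mem_nhds_iff' {x : X} {N : Set X} :
    N ∈ @nhds X S.toUniformSpace.toTopologicalSpace x ↔ ∃ r > 0, ∀ u, S.dist u x < r → u ∈ N :=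
  let := S.toMetricSpace; Metric.mem_nhds_iff

theorem convTo_iff_tendsto {y : ι → X} {x : X} :
    S.ConvTo l y x ↔ Tendsto y l (@nhds X S.toUniformSpace.toTopologicalSpace x) :=
  let := S.toMetricSpace; tendsto_iff_dist_tendsto_zero.symm

variable {S}

theorem ConvTo.eventually_lt {y : ι → X} {x : X} (h : S.ConvTo l y x) {r : ℝ} (hr : 0 < r) :
    ∀ᶠ i in l, S.dist (y i) x < r :=
  h.eventually_lt_const hr

theorem convTo_const (x : X) : S.ConvTo l (fun _ => x) x := by
  simpa only [ConvTo, dist_self'] using tendsto_const_nhds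

theorem ConvTo.mono {l' : Filter ι} {y : ι → X} {x : X} (h : S.ConvTo l y x) (hl : l' ≤ l) :
    S.ConvTo l' y x :=
  Tendsto.mono_left h hl

theorem ConvTo.dist {y z : ι → X} {x x' : X} (hy : S.ConvTo l y x) (hz : S.ConvTo l z x') :
    Tendsto (fun i => S.dist (y i) (z i)) l (𝓝 (S.dist x x')) := by
  let := S.toMetricSpace
  exact Tendsto.dist (S.convTo_iff_tendsto.1 hy) (S.convTo_iff_tendsto.1 hz)

theorem ConvTo.of_dist {y z : ι → X} {x : X} (hy : S.ConvTo l y x)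
    (h : Tendsto (fun i => S.dist (y i) (z i)) l (𝓝 0)) : S.ConvTo l z x := by
  have h2 := h.add hy
  rw [add_zero] at h2
  refine squeeze_zero (fun i => S.dist_nonneg' _ _) (fun i => ?_) h2
  rw [S.dist_comm' (y i)]
  exact S.dist_triangle' _ _ _

theorem convTo_of_ultrafilter {y : ι → X} {x : X}
    (h : ∀ G : Ultrafilter ι, ↑G ≤ l → S.ConvTo G y x) : S.ConvTo l y x := by
  rw [convTo_iff_tendsto, tendsto_iff_ultrafilter]
  exact fun G hG => S.convTo_iff_tendsto.1 (h G hG)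

theorem FirstOrderEq.mono {l' : Filter ι} {p q : ι → X} (h : S.FirstOrderEq l e p q)
    (hl : l' ≤ l) : S.FirstOrderEq l' e p q :=
  Tendsto.mono_left h hl

theorem FirstOrderEq.symm {p q : ι → X} (h : S.FirstOrderEq l e p q) :
    S.FirstOrderEq l e q p := by
  simpa only [FirstOrderEq, S.dist_comm'] using h

theorem FirstOrderEq.trans {p q r : ι → X} (he : ∀ᶠ i in l, 0 < e i)
    (h : S.FirstOrderEq l e p q) (h' : S.FirstOrderEq l e q r) : S.FirstOrderEq l e p r := by
  have h2 := Tendsto.add h h'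
  rw [add_zero] at h2
  refine squeeze_zero' ?_ ?_ h2
  · filter_upwards [he] with i hi using div_nonneg (S.dist_nonneg' _ _) hi.le
  · filter_upwards [he] with i hi
    rw [← add_div]
    exact div_le_div_of_nonneg_right (S.dist_triangle' _ _ _) hi.le

theorem FirstOrderEq.congr' {p q p' q' : ι → X} (h : S.FirstOrderEq l e p q)
    (hp : ∀ᶠ i in l, p i = p' i) (hq : ∀ᶠ i in l, q i = q' i) : S.FirstOrderEq l e p' q' := by
  refine Tendsto.congr' ?_ h
  filter_upwards [hp, hq] with i h1 h2
  rw [h1, h2]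

theorem firstOrderEq_iff {p q : ι → X} (he : ∀ᶠ i in l, 0 < e i) :
    S.FirstOrderEq l e p q ↔ ∀ η > 0, ∀ᶠ i in l, S.dist (p i) (q i) ≤ η * e i := by
  constructor
  · intro h η hη
    filter_upwards [he, h.eventually_lt_const hη] with i hi h1
    exact ((div_lt_iff₀ hi).1 h1).le
  · intro h
    rw [FirstOrderEq, Metric.tendsto_nhds]
    intro η hη
    filter_upwards [he, h (η / 2) (half_pos hη)] with i hi h1
    rw [Real.dist_eq, sub_zero, abs_of_nonneg (div_nonneg (S.dist_nonneg' _ _) hi.le),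
      div_lt_iff₀ hi]
    nlinarith

theorem FirstOrderEq.convTo {p q : ι → X} {x : X} (he : Tendsto e l (𝓝[>] 0))
    (h : S.FirstOrderEq l e p q) (hp : S.ConvTo l p x) : S.ConvTo l q x := by
  refine hp.of_dist ?_
  have h2 := Tendsto.mul h (tendsto_nhds_of_tendsto_nhdsWithin he)
  rw [mul_zero] at h2
  refine h2.congr' ?_
  filter_upwards [he.eventually self_mem_nhdsWithin] with i (hi : 0 < e i)
  rw [div_mul_cancel₀ _ hi.ne']

end Metric

/-! ### Compositions and inverses of dilatations -/

section Algebra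

variable (S : StrongDilatationStructure X) {x u v z : X} {ε μ : ℝ}

theorem mem_U (h : S.dist u x ≤ S.A) : u ∈ S.U x :=
  S.closedBall_subset x h

theorem δ_mem_U (hu : u ∈ S.U x) (hμ : 0 < μ) (hμ1 : μ ≤ 1) : S.δ μ x u ∈ S.U x := by
  have := S.δ_mul_dom x 1 μ one_pos hμ hμ1 u hu (Or.inl ⟨by linarith, hu⟩)
  simpa using this

theorem δ_δ_of_mul_le_one (hu : u ∈ S.U x) (hε : 0 < ε) (hμ : 0 < μ) (hμ1 : μ ≤ 1)
    (h : ε * μ ≤ 1) : S.δ μ x u ∈ S.dom ε x ∧ S.δ ε x (S.δ μ x u) = S.δ (ε * μ) x u := by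
  have h1 := S.δ_mul_dom x ε μ hε hμ hμ1 u hu (Or.inl ⟨h, hu⟩)
  exact ⟨h1, (S.δ_mul x ε μ hε hμ u hu (Or.inl ⟨hμ1, hu⟩) h1).2⟩

theorem δ_δ (hu : u ∈ S.U x) (hε : 0 < ε) (hε1 : ε ≤ 1) (hμ : 0 < μ) (hμ1 : μ ≤ 1) :
    S.δ ε x (S.δ μ x u) = S.δ (ε * μ) x u :=
  (S.δ_δ_of_mul_le_one hu hε hμ hμ1 (mul_le_one₀ hε1 hμ.le hμ1)).2

theorem δ_inv_δ (hu : u ∈ S.U x) (hε : 0 < ε) (hε1 : ε ≤ 1) :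
    S.δ ε x u ∈ S.dom ε⁻¹ x ∧ S.δ ε⁻¹ x (S.δ ε x u) = u := by
  have h := S.δ_δ_of_mul_le_one hu (inv_pos.2 hε) hε hε1 (inv_mul_cancel₀ hε.ne').le
  rwa [inv_mul_cancel₀ hε.ne', S.δ_one x u hu] at h

theorem δ_injective (hu : u ∈ S.U x) (hv : v ∈ S.U x) (hε : 0 < ε) (hε1 : ε ≤ 1)
    (h : S.δ ε x u = S.δ ε x v) : u = v := by
  rw [← (S.δ_inv_δ hu hε hε1).2, h, (S.δ_inv_δ hv hε hε1).2]

theorem δ_δ_inv (hε : 0 < ε) (hε1 : ε < 1) (hz : z ∈ S.W ε⁻¹ x) :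
    S.δ ε⁻¹ x z ∈ S.U x ∧ S.δ ε x (S.δ ε⁻¹ x z) = z := by
  obtain ⟨u, ⟨-, hu⟩, rfl⟩ := (S.inclusions x ε hε hε1).2.2.2 hz
  rw [(S.δ_inv_δ hu hε hε1.le).2]
  exact ⟨hu, rfl⟩

theorem exists_δ_eq (hε : 0 < ε) (hε1 : ε < 1) (hz : S.dist z x < ε) :
    z ∈ S.W ε⁻¹ x ∧ ∃ u, S.dist u x < S.A ∧ u ∈ S.U x ∧ S.δ ε x u = z := by
  obtain ⟨h1, h2, h3, -⟩ := S.inclusions x ε hε hε1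
  obtain ⟨u, hu, rfl⟩ := h1 hz
  exact ⟨h3 (h2 ⟨u, hu, rfl⟩), u, hu, S.mem_U (le_of_lt hu), rfl⟩

end Algebra

/-! ### Continuity of dilatations -/

section Continuity

variable {S : StrongDilatationStructure X} {ι : Type*} {l : Filter ι} {e : ι → ℝ}
  {x u₀ : X} {y u : ι → X}

theorem ConvTo.mem_U (hy : S.ConvTo l y x) (hu : S.ConvTo l u u₀) (h : S.dist u₀ x < S.A) :
    ∀ᶠ i in l, u i ∈ S.U (y i) := by
  filter_upwards [(hu.dist hy).eventually_lt_const h] with i hi using S.mem_U hi.le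

theorem ConvTo.δ_const {ε : ℝ} (hε : 0 < ε) (hy : S.ConvTo l y x) (hu : S.ConvTo l u u₀)
    (h : ∀ᶠ i in l, u i ∈ S.dom ε (y i)) (h₀ : u₀ ∈ S.dom ε x) :
    S.ConvTo l (fun i => S.δ ε (y i) (u i)) (S.δ ε x u₀) := by
  let := S.toMetricSpace
  obtain ⟨E, hE, hEδ, -⟩ := S.continuous_ext
  rw [convTo_iff_tendsto] at hy hu ⊢
  have h1 := (hE (ε, x, u₀) (subset_closure ⟨hε, h₀⟩)).tendsto
  rw [hEδ ε x u₀ hε h₀] at h1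
  refine (h1.comp (f := fun i => (ε, y i, u i)) (tendsto_nhdsWithin_iff.2
    ⟨tendsto_const_nhds.prodMk_nhds (hy.prodMk_nhds hu), ?_⟩)).congr' ?_
  · filter_upwards [h] with i hi using subset_closure ⟨hε, hi⟩
  · filter_upwards [h] with i hi using hEδ ε _ _ hε hi

theorem ConvTo.δ_zero (he : Tendsto e l (𝓝[>] 0)) (hy : S.ConvTo l y x) (hu : S.ConvTo l u u₀)
    (h : ∀ᶠ i in l, u i ∈ S.U (y i)) (h₀ : u₀ ∈ S.U x) :
    S.ConvTo l (fun i => S.δ (e i) (y i) (u i)) x := by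
  let := S.toMetricSpace
  obtain ⟨E, hE, hEδ, hE0⟩ := S.continuous_ext
  rw [convTo_iff_tendsto] at hy hu ⊢
  have hmem : ((0 : ℝ), x, u₀) ∈ closure {p : ℝ × X × X | 0 < p.1 ∧
      ((p.1 ≤ 1 ∧ p.2.2 ∈ S.U p.2.1) ∨ (1 < p.1 ∧ p.2.2 ∈ S.W p.1 p.2.1))} := by
    refine mem_closure_of_tendsto (f := fun t : ℝ => (t, x, u₀)) (b := 𝓝[>] 0)
      ((tendsto_id.mono_left nhdsWithin_le_nhds).prodMk_nhds tendsto_const_nhds) ?_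
    filter_upwards [Ioo_mem_nhdsGT (zero_lt_one' ℝ)] with t ht using
      ⟨ht.1, Or.inl ⟨ht.2.le, h₀⟩⟩
  have h1 := (hE _ hmem).tendsto
  rw [hE0 _ _ hmem] at h1
  have hd : ∀ᶠ i in l, 0 < e i ∧ ((e i ≤ 1 ∧ u i ∈ S.U (y i)) ∨ (1 < e i ∧ u i ∈ S.W (e i) (y i)))
      := by
    filter_upwards [h, he.eventually (Ioo_mem_nhdsGT (zero_lt_one' ℝ))] with i hi hei using
      ⟨hei.1, Or.inl ⟨hei.2.le, hi⟩⟩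
  refine (h1.comp (f := fun i => (e i, y i, u i)) (tendsto_nhdsWithin_iff.2
    ⟨(tendsto_nhds_of_tendsto_nhdsWithin he).prodMk_nhds (hy.prodMk_nhds hu), ?_⟩)).congr' ?_
  · filter_upwards [hd] with i hi using subset_closure hi
  · filter_upwards [hd] with i hi using hEδ _ _ _ hi.1 hi.2

theorem δ_convTo_base (he : Tendsto e l (𝓝[>] 0)) (h₀ : u₀ ∈ S.U x) :
    S.ConvTo l (fun i => S.δ (e i) x u₀) x :=
  (convTo_const x).δ_zero he (convTo_const u₀) (Eventually.of_forall fun _ => h₀) h₀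

end Continuity

/-! ### Rescaled distances -/

section Rescaling

variable (S : StrongDilatationStructure X) (x : X)

theorem isCompact_closedBall_one :
    @IsCompact X S.toUniformSpace.toTopologicalSpace {u | S.dist u x ≤ 1} := by
  let := S.toMetricSpace
  exact (S.compact_closedBall x).of_isClosed_subset Metric.isClosed_closedBall
    (Metric.closedBall_subset_closedBall (by norm_num))

theorem exists_convTo_of_ultrafilter {ι : Type*} (G : Ultrafilter ι) {w : ι → X}
    (h : ∀ᶠ i in (G : Filter ι), S.dist (w i) x ≤ 1) :
    ∃ w₀, S.dist w₀ x ≤ 1 ∧ S.ConvTo G w w₀ := by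
  let := S.toMetricSpace
  obtain ⟨w₀, hw, hw'⟩ := isCompact_iff_ultrafilter_le_nhds.1 (S.isCompact_closedBall_one x)
    (G.map w) (le_principal_iff.2 h)
  exact ⟨w₀, hw, S.convTo_iff_tendsto.2 hw'⟩

/-- The rescaled distances are uniformly Cauchy as the scale tends to zero. -/
theorem exists_rescaled_dist_le {η : ℝ} (hη : 0 < η) : ∃ ε₀ > 0, ε₀ ≤ 1 ∧
    ∀ y u v, S.dist y x ≤ 1 → S.dist u y ≤ S.A → S.dist v y ≤ S.A →
      ∀ ε ε' : ℝ, 0 < ε → ε < ε₀ → 0 < ε' → ε' < ε₀ →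
        S.dist (S.δ ε y u) (S.δ ε y v) / ε ≤ S.dist (S.δ ε' y u) (S.δ ε' y v) / ε' + η := by
  have h := S.tendsto_tdist _ (S.isCompact_closedBall_one x) (η / 2) (half_pos hη)
  obtain ⟨ε₀, hε₀, h⟩ := (mem_nhdsGT_iff_exists_Ioo_subset).1 h
  refine ⟨min ε₀ 1, lt_min hε₀ one_pos, min_le_right _ _, ?_⟩
  intro y u v hy hu hv ε ε' hε hε1 hε' hε1'
  have h1 := abs_le.1 (h ⟨hε, hε1.trans_le (min_le_left _ _)⟩ y hy u hu v hv)
  have h2 := abs_le.1 (h ⟨hε', hε1'.trans_le (min_le_left _ _)⟩ y hy u hu v hv)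
  have h3 := h1.2
  have h4 := h2.1
  change S.dist (S.δ ε y u) (S.δ ε y v) / ε - S.tdist y u v ≤ η / 2 at h3
  change -(η / 2) ≤ S.dist (S.δ ε' y u) (S.δ ε' y v) / ε' - S.tdist y u v at h4
  linarith

theorem tendsto_rescaled_dist {u v : X} (hu : S.dist u x ≤ S.A) (hv : S.dist v x ≤ S.A) :
    Tendsto (fun ε => S.dist (S.δ ε x u) (S.δ ε x v) / ε) (𝓝[>] 0) (𝓝 (S.tdist x u v)) := by
  rw [Metric.tendsto_nhds]
  intro η hη
  have h := S.tendsto_tdist {x} (@isCompact_singleton _ S.toUniformSpace.toTopologicalSpace _)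
    (η / 2) (half_pos hη)
  filter_upwards [h] with ε hε
  exact (hε x rfl u hu v hv).trans_lt (half_lt_self hη)

variable {x} in
/-- The dilatations separate points to first order. -/
theorem eq_of_firstOrderEq {u v : X} (hu : u ∈ S.U x) (hv : v ∈ S.U x)
    (h : S.FirstOrderEq (𝓝[>] 0) id (fun ε => S.δ ε x u) (fun ε => S.δ ε x v)) : u = v := by
  -- The points are first shrunk into the ball of radius `A`, where `tdist x` is a distance.
  have hA : 0 < S.A := one_pos.trans S.one_lt_A
  obtain ⟨μ, hμu, hμv, hμ, hμ1⟩ := ((((δ_convTo_base tendsto_id hu).eventually_lt hA).and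
    (((δ_convTo_base tendsto_id hv).eventually_lt hA).and
      (Ioo_mem_nhdsGT (zero_lt_one' ℝ)))).exists)
  simp only [id] at hμu hμv
  refine S.δ_injective hu hv hμ hμ1.le ?_
  refine (S.tdist_eq_zero x _ hμu.le _ hμv.le).1
    (tendsto_nhds_unique (S.tendsto_rescaled_dist x hμu.le hμv.le) ?_)
  have hm : Tendsto (fun ε : ℝ => ε * μ) (𝓝[>] 0) (𝓝[>] 0) := by
    refine tendsto_nhdsWithin_iff.2 ⟨?_, ?_⟩
    · exact ((continuous_mul_const μ).tendsto' 0 0 (zero_mul μ)).mono_left nhdsWithin_le_nhds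
    · filter_upwards [self_mem_nhdsWithin] with ε hε using mul_pos hε hμ
  have h1 := (Tendsto.comp h hm).const_mul μ
  rw [mul_zero] at h1
  refine h1.congr' ?_
  filter_upwards [Ioo_mem_nhdsGT (zero_lt_one' ℝ)] with ε hε
  have := hε.1.ne'
  rw [S.δ_δ hu hε.1 hε.2.le hμ hμ1.le, S.δ_δ hv hε.1 hε.2.le hμ hμ1.le]
  simp only [Function.comp, id]
  field_simp

/-- A point whose image under `δ ε y` lies at distance less than `κ * ε` from the base point is
itself at distance at most `2 * κ` from it, uniformly in the scale `ε`. -/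
theorem exists_dist_le_of_dist_δ_lt : ∃ κ₀ > 0, κ₀ ≤ 1 ∧ ∀ (y w : X) (κ ε : ℝ),
    S.dist y x ≤ 1 → 0 < κ → κ < κ₀ → 0 < ε → ε ≤ 1 → w ∈ S.U y →
      S.dist (S.δ ε y w) y < κ * ε → S.dist w y ≤ 2 * κ := by
  obtain ⟨κ₀, hκ₀, hκ₁, h⟩ := S.exists_rescaled_dist_le x one_pos
  refine ⟨κ₀, hκ₀, hκ₁, fun y w κ ε hy hκ hκ' hε hε1 hw hd => ?_⟩
  have hle : κ * ε ≤ κ := mul_le_of_le_one_right hκ.le hε1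
  obtain ⟨-, w', hw', hwU, he⟩ := S.exists_δ_eq (mul_pos hκ hε) (by linarith) hd
  rw [mul_comm, ← S.δ_δ hwU hε hε1 hκ (by linarith)] at he
  obtain rfl := S.δ_injective (S.δ_mem_U hwU hκ (by linarith)) hw hε hε1 he
  have hyy : S.dist y y ≤ S.A := by
    rw [S.dist_self']; exact (one_pos.trans S.one_lt_A).le
  have h1 := h y w' y hy hw'.le hyy κ (κ * ε) hκ hκ' (mul_pos hκ hε) (by linarith)
  rw [S.δ_self y κ hκ, S.δ_self y _ (mul_pos hκ hε), mul_comm κ ε,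
    ← S.δ_δ hwU hε hε1 hκ (by linarith), mul_comm ε κ] at h1
  have h2 := (div_lt_one (mul_pos hκ hε)).2 hd
  rw [div_le_iff₀ hκ] at h1
  nlinarith

end Rescaling

/-! ### First order behaviour of dilatations -/

section Limits

variable {S : StrongDilatationStructure X} {ι : Type*} {l : Filter ι} {e : ι → ℝ}
  {x u₀ : X} {y u v : ι → X}

theorem ConvTo.firstOrderEq_δ (he : Tendsto e l (𝓝[>] 0)) (hy : S.ConvTo l y x)
    (hu : S.ConvTo l u u₀) (hv : S.ConvTo l v u₀) (h : S.dist u₀ x < S.A) :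
    S.FirstOrderEq l e (fun i => S.δ (e i) (y i) (u i)) (fun i => S.δ (e i) (y i) (v i)) := by
  have he0 : ∀ᶠ i in l, 0 < e i := he.eventually self_mem_nhdsWithin
  refine (firstOrderEq_iff he0).2 fun η hη => ?_
  obtain ⟨ε₀, hε₀, hε₁, hC⟩ := S.exists_rescaled_dist_le x (half_pos hη)
  have h₀ : u₀ ∈ S.dom (ε₀ / 2) x := Or.inl ⟨by linarith, S.mem_U h.le⟩
  have hdom : ∀ {w : ι → X}, S.ConvTo l w u₀ → ∀ᶠ i in l, w i ∈ S.dom (ε₀ / 2) (y i) := by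
    intro w hw
    filter_upwards [hy.mem_U hw h] with i hi using Or.inl ⟨by linarith, hi⟩
  have h1 := (hy.δ_const (half_pos hε₀) hu (hdom hu) h₀).dist
    (hy.δ_const (half_pos hε₀) hv (hdom hv) h₀)
  rw [S.dist_self'] at h1
  filter_upwards [h1.eventually_lt_const (mul_pos (half_pos hη) (half_pos hε₀)),
    he.eventually (Ioo_mem_nhdsGT hε₀), hy.eventually_lt one_pos,
    (hu.dist hy).eventually_lt_const h, (hv.dist hy).eventually_lt_const h] with i h2 h3 h4 h5 h6
  have h7 := hC (y i) (u i) (v i) h4.le h5.le h6.le (e i) (ε₀ / 2) h3.1 h3.2 (half_pos hε₀)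
    (by linarith)
  rw [← div_lt_iff₀ (half_pos hε₀)] at h2
  rw [← div_le_iff₀ h3.1]
  linarith

variable (S x) in
theorem exists_dist_δ_le {κ : ℝ} (hκ : 0 < κ) : ∃ ρ > 0, ∀ (y u : X) (ε : ℝ),
    S.dist y x < ρ → S.dist u x < ρ → 0 < ε → ε < ρ → S.dist (S.δ ε y u) y ≤ κ * ε := by
  by_contra! hcon
  have hpos : ∀ n : ℕ, 0 < 1 / ((n : ℝ) + 1) := fun n => Nat.one_div_pos_of_nat
  choose y u e hy hu he he' hd using fun n : ℕ => hcon _ (hpos n)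
  have hlim := tendsto_one_div_add_atTop_nhds_zero_nat (𝕜 := ℝ)
  have hy' : S.ConvTo atTop y x :=
    squeeze_zero (fun n => S.dist_nonneg' _ _) (fun n => (hy n).le) hlim
  have hu' : S.ConvTo atTop u x :=
    squeeze_zero (fun n => S.dist_nonneg' _ _) (fun n => (hu n).le) hlim
  have hE : Tendsto e atTop (𝓝[>] 0) := tendsto_nhdsWithin_iff.2
    ⟨squeeze_zero (fun n => (he n).le) (fun n => (he' n).le) hlim, Eventually.of_forall he⟩
  have h0 : S.dist x x < S.A := by
    rw [S.dist_self']; exact one_pos.trans S.one_lt_A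
  have h1 := (firstOrderEq_iff (Eventually.of_forall he)).1 (hy'.firstOrderEq_δ hE hu' hy' h0) κ hκ
  obtain ⟨n, hn⟩ := h1.exists
  rw [S.δ_self _ _ (he n)] at hn
  exact absurd hn (hd n).not_ge

/-- Pointwise first order agreement of the limit, obtained from a first order agreement along a
family whose scale tends to zero. -/
theorem FirstOrderEq.of_convTo [l.NeBot] {v₀ : X} (he : Tendsto e l (𝓝[>] 0))
    (hy : S.ConvTo l y x) (hu : S.ConvTo l u u₀) (hv : S.ConvTo l v v₀) (hu₀ : S.dist u₀ x < S.A)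
    (hv₀ : S.dist v₀ x < S.A)
    (h : S.FirstOrderEq l e (fun i => S.δ (e i) (y i) (u i)) (fun i => S.δ (e i) (y i) (v i))) :
    S.FirstOrderEq (𝓝[>] 0) id (fun ε => S.δ ε x u₀) (fun ε => S.δ ε x v₀) := by
  have he0 : ∀ᶠ i in l, 0 < e i := he.eventually self_mem_nhdsWithin
  refine (firstOrderEq_iff self_mem_nhdsWithin).2 fun η hη => ?_
  obtain ⟨ε₀, hε₀, hε₁, hC⟩ := S.exists_rescaled_dist_le x (half_pos hη)
  filter_upwards [Ioo_mem_nhdsGT hε₀] with ε hε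
  have hε1 : ε ≤ 1 := hε.2.le.trans hε₁
  have hdom : ∀ {w : ι → X} {w₀ : X}, S.ConvTo l w w₀ → S.dist w₀ x < S.A →
      S.ConvTo l (fun i => S.δ ε (y i) (w i)) (S.δ ε x w₀) := by
    intro w w₀ hw h0
    refine hy.δ_const hε.1 hw ?_ (Or.inl ⟨hε1, S.mem_U h0.le⟩)
    filter_upwards [hy.mem_U hw h0] with i hi using Or.inl ⟨hε1, hi⟩
  refine le_of_tendsto ((hdom hu hu₀).dist (hdom hv hv₀)) ?_
  filter_upwards [h.eventually_lt_const (half_pos hη), he.eventually (Ioo_mem_nhdsGT hε₀),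
    hy.eventually_lt one_pos, (hu.dist hy).eventually_lt_const hu₀,
    (hv.dist hy).eventually_lt_const hv₀] with i h2 h3 h4 h5 h6
  have h7 := hC (y i) (u i) (v i) h4.le h5.le h6.le ε (e i) hε.1 hε.2 h3.1 h3.2
  rw [← div_le_iff₀ hε.1]
  linarith

variable (S x) in
/-- Near `x`, the dilatations of small coefficient have equicontinuous inverses: first order
agreement of the images forces convergence of the points. -/
theorem exists_convTo_of_firstOrderEq : ∃ ρ > 0, ∀ (u₀ : X), S.dist u₀ x < ρ →
    ∀ {ι : Type*} {l : Filter ι} {e : ι → ℝ} {y u w : ι → X}, Tendsto e l (𝓝[>] 0) →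
      S.ConvTo l y x → S.ConvTo l u u₀ → (∀ᶠ i in l, w i ∈ S.U (y i)) →
      S.FirstOrderEq l e (fun i => S.δ (e i) (y i) (u i)) (fun i => S.δ (e i) (y i) (w i)) →
      S.ConvTo l w u₀ := by
  obtain ⟨κ₀, hκ₀, hκ₁, hnear⟩ := S.exists_dist_le_of_dist_δ_lt x
  obtain ⟨κ, hκ, hκ', hκ4⟩ : ∃ κ : ℝ, 0 < κ ∧ κ < κ₀ ∧ κ ≤ 1 / 4 :=
    ⟨min (κ₀ / 2) (1 / 4), by positivity,
      (min_le_left _ _).trans_lt (half_lt_self hκ₀), min_le_right _ _⟩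
  obtain ⟨ρ, hρ, hfar⟩ := S.exists_dist_δ_le x (half_pos hκ)
  have hA := S.one_lt_A
  refine ⟨min ρ 1, lt_min hρ one_pos, ?_⟩
  intro u₀ hu₀ ι l e y u w he hy hu hw h
  have he0 : ∀ᶠ i in l, 0 < e i := he.eventually self_mem_nhdsWithin
  have hbd : ∀ᶠ i in l, S.dist (w i) x ≤ 1 := by
    have hu1 := (hu.dist (convTo_const x)).eventually_lt_const (hu₀.trans_le (min_le_left _ _))
    filter_upwards [hw, he.eventually (Ioo_mem_nhdsGT (lt_min hρ one_pos)), hu1,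
      hy.eventually_lt (lt_min hρ (half_pos one_pos)),
      (firstOrderEq_iff he0).1 h (κ / 4) (by positivity)] with i h1 h2 h3 h4 h5
    have h6 := hfar (y i) (u i) (e i) (h4.trans_le (min_le_left _ _)) h3 h2.1
      (h2.2.trans_le (min_le_left _ _))
    have h7 := S.dist_triangle' (S.δ (e i) (y i) (w i)) (S.δ (e i) (y i) (u i)) (y i)
    rw [S.dist_comm'] at h5
    have h4' := h4.trans_le (min_le_right _ _)
    have h8 := hnear (y i) (w i) κ (e i) (by linarith) hκ hκ' h2.1
      (h2.2.le.trans (min_le_right _ _)) h1 (by nlinarith [h2.1, mul_pos hκ h2.1])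
    have h9 := S.dist_triangle' (w i) (y i) x
    linarith
  refine convTo_of_ultrafilter fun G hG => ?_
  obtain ⟨w₀, hw₀, hlim⟩ := S.exists_convTo_of_ultrafilter x G (hbd.filter_mono hG)
  have hu₀' := hu₀.trans_le (min_le_right _ _)
  have h1 := (h.mono hG).of_convTo (he.mono_left hG) (hy.mono hG) (hu.mono hG) hlim
    (by linarith) (by linarith)
  rwa [S.eq_of_firstOrderEq (S.mem_U (by linarith)) (S.mem_U (by linarith)) h1]

variable (S x) in
/-- The approximate differences `δ_{ε⁻¹}^{δ_ε^y a} δ_ε^y v` converge to `v` when `y` and `a` tend to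
the same point: the difference with the neutral element is the identity. This is where the strong
axiom enters. -/
theorem exists_difference_convTo : ∃ ρ > 0, ∀ (v₀ : X), S.dist v₀ x < ρ →
    ∀ {ι : Type*} {l : Filter ι} {e : ι → ℝ} {y a v : ι → X}, Tendsto e l (𝓝[>] 0) →
      S.ConvTo l y x → S.ConvTo l a x → S.ConvTo l v v₀ →
      (∀ᶠ i in l, S.δ (e i) (y i) (v i) ∈ S.W (e i)⁻¹ (S.δ (e i) (y i) (a i))) ∧
      S.ConvTo l (fun i => S.δ (e i)⁻¹ (S.δ (e i) (y i) (a i)) (S.δ (e i) (y i) (v i))) v₀ := by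
  obtain ⟨R₁, hR₁, ε₀, hε₀, hε₁, hW⟩ := S.mem_W _ (S.isCompact_closedBall_one x)
  obtain ⟨Δ, hΔ⟩ := S.tendsto_difference
  obtain ⟨R₂, hR₂, hΔ⟩ := hΔ _ (S.isCompact_closedBall_one x)
  have hA := S.one_lt_A
  refine ⟨min (min R₁ R₂) 1, by positivity, ?_⟩
  intro v₀ hv₀ ι l e y a v he hy ha hv
  rw [lt_min_iff, lt_min_iff] at hv₀
  obtain ⟨⟨hv1, hv2⟩, hv3⟩ := hv₀
  have ha0 := ha.dist hy
  rw [S.dist_self'] at ha0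
  have hR : ∀ᶠ i in l, S.dist (y i) x ≤ 1 ∧ S.dist (a i) (y i) ≤ R₁ ∧ S.dist (a i) (y i) ≤ R₂ ∧
      S.dist (v i) (y i) ≤ R₁ ∧ S.dist (v i) (y i) ≤ R₂ := by
    filter_upwards [hy.eventually_lt one_pos, ha0.eventually_lt_const hR₁,
      ha0.eventually_lt_const hR₂, (hv.dist hy).eventually_lt_const hv1,
      (hv.dist hy).eventually_lt_const hv2] with i h1 h2 h3 h4 h5
    exact ⟨h1.le, h2.le, h3.le, h4.le, h5.le⟩
  constructor
  · filter_upwards [hR, he.eventually (Ioo_mem_nhdsGT hε₀)] with i hi hei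
    exact hW (y i) hi.1 (a i) hi.2.1 (v i) hi.2.2.2.1 (e i) hei.1 hei.2
  · rw [ConvTo, Metric.tendsto_nhds]
    intro η hη
    have hη3 : 0 < η / 3 := by positivity
    -- By uniformity, it suffices to compare with the differences at a fixed scale `ε`.
    obtain ⟨ε, hεΔ, hε, hε'⟩ := ((hΔ (η / 3) hη3).and
      (Ioo_mem_nhdsGT hε₀)).exists
    have hx : x ∈ S.U x := S.mem_U (by rw [S.dist_self']; linarith)
    have hvx : v₀ ∈ S.U x := S.mem_U (by linarith)
    have hε1 : ε ≤ 1 := by linarith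
    have hya : S.ConvTo l (fun i => S.δ ε (y i) (a i)) x := by
      have := hy.δ_const hε ha ((hy.mem_U ha (by rw [S.dist_self']; linarith)).mono
        fun i hi => Or.inl ⟨hε1, hi⟩) (Or.inl ⟨hε1, hx⟩)
      rwa [S.δ_self x ε hε] at this
    have hyv : S.ConvTo l (fun i => S.δ ε (y i) (v i)) (S.δ ε x v₀) :=
      hy.δ_const hε hv ((hy.mem_U hv (by linarith)).mono fun i hi => Or.inl ⟨hε1, hi⟩)
        (Or.inl ⟨hε1, hvx⟩)
    have hfix : S.ConvTo l (fun i => S.δ ε⁻¹ (S.δ ε (y i) (a i)) (S.δ ε (y i) (v i))) v₀ := by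
      have := hya.δ_const (inv_pos.2 hε) hyv (by
        filter_upwards [hR] with i hi
        exact Or.inr ⟨(one_lt_inv₀ hε).2 (by linarith),
          hW (y i) hi.1 (a i) hi.2.1 (v i) hi.2.2.2.1 ε hε hε'⟩) (S.δ_inv_δ hvx hε hε1).1
      rwa [(S.δ_inv_δ hvx hε hε1).2] at this
    filter_upwards [hR, he.eventually (hΔ (η / 3) hη3), hfix.eventually_lt hη3] with i h1 h2 h3
    have h4 := h2 (y i) h1.1 (a i) h1.2.2.1 (v i) h1.2.2.2.2
    have h5 := hεΔ (y i) h1.1 (a i) h1.2.2.1 (v i) h1.2.2.2.2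
    rw [Real.dist_eq, sub_zero, abs_of_nonneg (S.dist_nonneg' _ _)]
    have h6 := S.dist_triangle' (S.δ (e i)⁻¹ (S.δ (e i) (y i) (a i)) (S.δ (e i) (y i) (v i)))
      (Δ (y i) (a i) (v i)) v₀
    have h7 := S.dist_triangle' (Δ (y i) (a i) (v i))
      (S.δ ε⁻¹ (S.δ ε (y i) (a i)) (S.δ ε (y i) (v i))) v₀
    rw [S.dist_comm' (Δ (y i) (a i) (v i)) (S.δ ε⁻¹ _ _)] at h7
    change S.dist _ _ ≤ _ at h4 h5
    linarith

variable (S x) in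
/-- To first order, the dilatations depend on the base point only to first order. -/
theorem exists_firstOrderEq_δ_base : ∃ ρ > 0, ∀ (v₀ : X), S.dist v₀ x < ρ →
    ∀ {ι : Type*} {l : Filter ι} {e : ι → ℝ} {y z v v' : ι → X}, Tendsto e l (𝓝[>] 0) →
      S.ConvTo l y x → S.FirstOrderEq l e y z → S.ConvTo l v v₀ → S.ConvTo l v' v₀ →
      S.FirstOrderEq l e (fun i => S.δ (e i) (y i) (v i)) (fun i => S.δ (e i) (z i) (v' i)) := by
  obtain ⟨ρ₁, hρ₁, hinv⟩ := S.exists_convTo_of_firstOrderEq x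
  obtain ⟨ρ₂, hρ₂, hdiff⟩ := S.exists_difference_convTo x
  have hA := S.one_lt_A
  refine ⟨min ρ₂ 1, by positivity, ?_⟩
  intro v₀ hv₀ ι l e y z v v' he hy hyz hv hv'
  rw [lt_min_iff] at hv₀
  have he0 : ∀ᶠ i in l, 0 < e i := he.eventually self_mem_nhdsWithin
  have he1 := he.eventually (Ioo_mem_nhdsGT (zero_lt_one' ℝ))
  have hz := hyz.convTo he hy
  -- The new base points are written as dilated points `δ_e^y a`, where `a` tends to `x`.
  have hex : ∀ i, ∃ a, (0 < e i ∧ e i < 1 ∧ S.dist (z i) (y i) < e i) →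
      a ∈ S.U (y i) ∧ S.δ (e i) (y i) a = z i := by
    intro i
    by_cases h : 0 < e i ∧ e i < 1 ∧ S.dist (z i) (y i) < e i
    · obtain ⟨-, a, -, ha⟩ := S.exists_δ_eq h.1 h.2.1 h.2.2
      exact ⟨a, fun _ => ha⟩
    · exact ⟨x, fun h' => absurd h' h⟩
  choose a ha using hex
  have ha' : ∀ᶠ i in l, a i ∈ S.U (y i) ∧ S.δ (e i) (y i) (a i) = z i := by
    filter_upwards [he1, (firstOrderEq_iff he0).1 hyz (1 / 2) (by positivity)] with i h1 h2
    refine ha i ⟨h1.1, h1.2, ?_⟩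
    rw [S.dist_comm']
    linarith [h1.1]
  have hax : S.ConvTo l a x := by
    refine hinv x (by rwa [S.dist_self']) he hy hy (ha'.mono fun i hi => hi.1) ?_
    exact hyz.congr' (he0.mono fun i hi => (S.δ_self _ _ hi).symm)
      (ha'.mono fun i hi => hi.2.symm)
  obtain ⟨hmem, hlim⟩ := hdiff v₀ hv₀.1 he hy hax hv
  refine (hz.firstOrderEq_δ he hlim hv' (by linarith)).congr' ?_
    (Eventually.of_forall fun _ => rfl)
  filter_upwards [hmem, ha', he1] with i h1 h2 h3
  rw [h2.2] at h1 ⊢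
  exact (S.δ_δ_inv h3.1 h3.2 h1).2

end Limits

/-! ### First order description of the local group operation -/

section Sum

variable {S : StrongDilatationStructure X} {x u v w : X}

theorem IsSum.firstOrderEq (hw : S.dist w x < S.A) (h : S.IsSum x u v w) :
    S.FirstOrderEq (𝓝[>] 0) id (fun ε => S.δ ε (S.δ ε x u) v) (fun ε => S.δ ε x w) := by
  obtain ⟨hdom, hlim⟩ := h
  refine ((convTo_const x).firstOrderEq_δ tendsto_id (S.convTo_iff_tendsto.2 hlim)
    (convTo_const w) hw).congr' ?_ (Eventually.of_forall fun _ => rfl)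
  filter_upwards [hdom, Ioo_mem_nhdsGT (zero_lt_one' ℝ)] with ε h1 h2
  exact (S.δ_δ_inv h2.1 h2.2 h1.2.2).2

variable (S x) in
theorem exists_isSum_of_firstOrderEq : ∃ ρ > 0, ∀ u v w : X, S.dist u x < ρ → S.dist v x < ρ →
    S.dist w x < ρ →
    S.FirstOrderEq (𝓝[>] 0) id (fun ε => S.δ ε (S.δ ε x u) v) (fun ε => S.δ ε x w) →
    S.IsSum x u v w := by
  obtain ⟨ρ₁, hρ₁, hinv⟩ := S.exists_convTo_of_firstOrderEq x
  obtain ⟨ρ₂, hρ₂, hfar⟩ := S.exists_dist_δ_le x (half_pos one_pos)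
  have hA := S.one_lt_A
  refine ⟨min (min ρ₁ ρ₂) 1, by positivity, ?_⟩
  intro u v w hu hv hw h
  simp only [lt_min_iff] at hu hv hw
  have huU : u ∈ S.U x := S.mem_U (by linarith)
  have hmem : ∀ᶠ ε : ℝ in 𝓝[>] 0, S.δ ε (S.δ ε x u) v ∈ S.W ε⁻¹ x := by
    filter_upwards [(firstOrderEq_iff self_mem_nhdsWithin).1 h (1 / 4) (by positivity),
      Ioo_mem_nhdsGT (lt_min hρ₂ one_pos)] with ε h1 h2
    obtain ⟨h2, h3⟩ := h2
    rw [lt_min_iff] at h3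
    refine (S.exists_δ_eq h2 h3.2 ?_).1
    have h4 := hfar x w ε (by rwa [S.dist_self']) hw.1.2 h2 h3.1
    have h5 := S.dist_triangle' (S.δ ε (S.δ ε x u) v) (S.δ ε x w) x
    linarith
  refine ⟨?_, ?_⟩
  · filter_upwards [hmem, (δ_convTo_base tendsto_id huU).mem_U (convTo_const v)
      (by linarith)] with ε h1 h2 using ⟨huU, h2, h1⟩
  · refine S.convTo_iff_tendsto.1 (hinv w hw.1.1 tendsto_id (convTo_const x) (convTo_const w) ?_
      (h.symm.congr' (Eventually.of_forall fun _ => rfl) ?_))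
    · filter_upwards [hmem, Ioo_mem_nhdsGT (zero_lt_one' ℝ)] with ε h1 h2
      exact (S.δ_δ_inv h2.1 h2.2 h1).1
    · filter_upwards [hmem, Ioo_mem_nhdsGT (zero_lt_one' ℝ)] with ε h1 h2
      exact (S.δ_δ_inv h2.1 h2.2 h1).2.symm

end Sum

/-! ### Transition functions -/

section Equivalence

variable {S T : StrongDilatationStructure X} {P Q : X → X → X}

theorem EquivalentVia.symm (h : EquivalentVia S T P Q) : EquivalentVia T S Q P := by
  obtain ⟨k, K, hk, hK, hd⟩ := h.bilipschitz
  refine ⟨⟨K⁻¹, k⁻¹, inv_pos.2 hK, inv_pos.2 hk, fun x y => ⟨?_, ?_⟩⟩,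
    h.transition_P, h.transition_Q⟩
  · rw [inv_mul_le_iff₀ hK]
    exact (hd x y).2
  · rw [le_inv_mul_iff₀ hk]
    exact (hd x y).1

theorem EquivalentVia.exists_dist_le (h : EquivalentVia S T P Q) :
    ∃ K > 0, ∀ x y, T.dist x y ≤ K * S.dist x y := by
  obtain ⟨_, K, _, hK, hd⟩ := h.bilipschitz
  exact ⟨K, hK, fun x y => (hd x y).2⟩

theorem EquivalentVia.convTo (h : EquivalentVia S T P Q) {ι : Type*} {l : Filter ι} {y : ι → X}
    {x : X} (hy : S.ConvTo l y x) : T.ConvTo l y x := by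
  obtain ⟨K, _, hd⟩ := h.exists_dist_le
  have h2 := Tendsto.const_mul K hy
  rw [mul_zero] at h2
  exact squeeze_zero (fun i => T.dist_nonneg' _ _) (fun i => hd _ _) h2

theorem EquivalentVia.firstOrderEq (h : EquivalentVia S T P Q) {ι : Type*} {l : Filter ι}
    {e : ι → ℝ} {p q : ι → X} (he : ∀ᶠ i in l, 0 < e i) (hy : S.FirstOrderEq l e p q) :
    T.FirstOrderEq l e p q := by
  obtain ⟨K, hK, hd⟩ := h.exists_dist_le
  refine (firstOrderEq_iff he).2 fun η hη => ?_
  filter_upwards [(firstOrderEq_iff he).1 hy (η / K) (div_pos hη hK)] with i hi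
  calc T.dist (p i) (q i) ≤ K * S.dist (p i) (q i) := hd _ _
    _ ≤ K * (η / K * e i) := mul_le_mul_of_nonneg_left hi hK.le
    _ = η * e i := by field_simp

/-- The transition property of `Q`, on the ball of centre `x` and radius `ρ` for both the base
points and the arguments. -/
def IsTransitionNear (S T : StrongDilatationStructure X) (Q : X → X → X) (x : X) (ρ : ℝ) : Prop :=
  (∀ y u, S.dist y x < ρ → S.dist u x < ρ → u ∈ S.U y ∧ Q y u ∈ T.U y) ∧
  ∀ η > 0, ∀ᶠ ε : ℝ in 𝓝[>] 0, ∀ y u, S.dist y x < ρ → S.dist u x < ρ →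
    T.dist (S.δ ε y u) (T.δ ε y (Q y u)) ≤ η * ε

theorem IsTransition.exists_near (h : IsTransition S T Q) (x : X) :
    ∃ ρ > 0, IsTransitionNear S T Q x ρ := by
  obtain ⟨r, hr, h1, h2⟩ := h _ (S.isCompact_closedBall_one x)
  have key : ∀ y u, S.dist y x < min 1 (r / 2) → S.dist u x < min 1 (r / 2) →
      S.dist y x ≤ 1 ∧ S.dist u x ≤ 1 ∧ S.dist y u ≤ r := by
    intro y u hy hu
    rw [lt_min_iff] at hy hu
    have := S.dist_triangle' y x u
    rw [S.dist_comm' x u] at this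
    exact ⟨hy.1.le, hu.1.le, by linarith⟩
  refine ⟨min 1 (r / 2), by positivity, ?_, ?_⟩
  · intro y u hy hu
    obtain ⟨a, b, c⟩ := key y u hy hu
    exact h1 y a u b c
  · intro η hη
    filter_upwards [h2 η hη, self_mem_nhdsWithin] with ε hε (hε0 : 0 < ε) y u hy hu
    obtain ⟨a, b, c⟩ := key y u hy hu
    exact (div_le_iff₀ hε0).1 (hε y a u b c)

namespace IsTransitionNear

variable {x : X} {ρ : ℝ}

theorem mono {ρ' : ℝ} (h : IsTransitionNear S T Q x ρ) (hρ : ρ' ≤ ρ) :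
    IsTransitionNear S T Q x ρ' :=
  ⟨fun y u hy hu => h.1 y u (hy.trans_le hρ) (hu.trans_le hρ), fun η hη =>
    (h.2 η hη).mono fun _ hε y u hy hu => hε y u (hy.trans_le hρ) (hu.trans_le hρ)⟩

theorem firstOrderEq (h : IsTransitionNear S T Q x ρ) {ι : Type*} {l : Filter ι} {e : ι → ℝ}
    {y u : ι → X} (he : Tendsto e l (𝓝[>] 0)) (hy : ∀ᶠ i in l, S.dist (y i) x < ρ)
    (hu : ∀ᶠ i in l, S.dist (u i) x < ρ) :
    T.FirstOrderEq l e (fun i => S.δ (e i) (y i) (u i))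
      (fun i => T.δ (e i) (y i) (Q (y i) (u i))) := by
  refine (firstOrderEq_iff (he.eventually self_mem_nhdsWithin)).2 fun η hη => ?_
  filter_upwards [he.eventually (h.2 η hη), hy, hu] with i h1 h2 h3 using h1 _ _ h2 h3

theorem firstOrderEq_const (h : IsTransitionNear S T Q x ρ) {u : X} (hu : S.dist u x < ρ)
    {l : Filter ℝ} {e : ℝ → ℝ} (he : Tendsto e l (𝓝[>] 0)) :
    T.FirstOrderEq l e (fun ε => S.δ (e ε) x u) (fun ε => T.δ (e ε) x (Q x u)) :=
  h.firstOrderEq he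
    (Eventually.of_forall fun _ => by
      rw [S.dist_self']
      exact (S.dist_nonneg' u x).trans_lt hu)
    (Eventually.of_forall fun _ => hu)

theorem map_self (h : IsTransitionNear S T Q x ρ) (hρ : 0 < ρ) : Q x x = x := by
  have hx : S.dist x x < ρ := by rwa [S.dist_self']
  have hA := T.one_lt_A
  refine T.eq_of_firstOrderEq (h.1 x x hx hx).2
    (T.mem_U (by rw [T.dist_self']; linarith)) ?_
  refine (h.firstOrderEq_const hx tendsto_id).symm.congr' (Eventually.of_forall fun _ => rfl) ?_
  filter_upwards [self_mem_nhdsWithin] with ε (hε : 0 < ε)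
  rw [T.δ_self x ε hε]
  exact S.δ_self x ε hε

/-- The transition functions commute with the dilatations. -/
theorem map_δ (h : IsTransitionNear S T Q x ρ) {u : X} {μ : ℝ} (hu : S.dist u x < ρ)
    (hμ : 0 < μ) (hμ1 : μ ≤ 1) (hu' : S.dist (S.δ μ x u) x < ρ) :
    Q x (S.δ μ x u) = T.δ μ x (Q x u) := by
  have hx : S.dist x x < ρ := by
    rw [S.dist_self']
    exact (S.dist_nonneg' u x).trans_lt hu
  obtain ⟨huS, huT⟩ := h.1 x u hx hu
  have hpos : ∀ᶠ ε : ℝ in 𝓝[>] 0, 0 < id ε := self_mem_nhdsWithin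
  have hm : Tendsto (fun ε : ℝ => ε * μ) (𝓝[>] 0) (𝓝[>] 0) := by
    refine tendsto_nhdsWithin_iff.2 ⟨?_, ?_⟩
    · exact ((continuous_mul_const μ).tendsto' 0 0 (zero_mul μ)).mono_left nhdsWithin_le_nhds
    · filter_upwards [self_mem_nhdsWithin] with ε hε using mul_pos hε hμ
  refine T.eq_of_firstOrderEq (h.1 x _ hx hu').2 (T.δ_mem_U huT hμ hμ1)
    (FirstOrderEq.trans hpos (h.firstOrderEq_const hu' tendsto_id).symm ?_)
  refine (firstOrderEq_iff hpos).2 fun η hη => ?_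
  filter_upwards [(firstOrderEq_iff (hm.eventually self_mem_nhdsWithin)).1
    (h.firstOrderEq_const hu hm) η hη, Ioo_mem_nhdsGT (zero_lt_one' ℝ)] with ε h1 h2
  rw [T.δ_δ huT h2.1 h2.2.le hμ hμ1, id, S.δ_δ huS h2.1 h2.2.le hμ hμ1]
  exact h1.trans (mul_le_mul_of_nonneg_left (mul_le_of_le_one_right h2.1.le hμ1) hη.le)

theorem map_map (h : EquivalentVia S T P Q) {ρ' : ℝ} (hQ : IsTransitionNear S T Q x ρ)
    (hP : IsTransitionNear T S P x ρ') {u : X} (hu : S.dist u x < ρ)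
    (hu' : T.dist (Q x u) x < ρ') : P x (Q x u) = u := by
  have hx : S.dist x x < ρ := by
    rw [S.dist_self']
    exact (S.dist_nonneg' u x).trans_lt hu
  have hx' : T.dist x x < ρ' := by
    rw [T.dist_self']
    exact (T.dist_nonneg' _ x).trans_lt hu'
  have hpos : ∀ᶠ ε : ℝ in 𝓝[>] 0, 0 < id ε := self_mem_nhdsWithin
  exact S.eq_of_firstOrderEq (hP.1 x _ hx' hu').2 (hQ.1 x u hx hu).1
    ((hP.firstOrderEq_const hu' tendsto_id).symm.trans hpos
      (h.symm.firstOrderEq hpos (hQ.firstOrderEq_const hu tendsto_id).symm))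

/-- The transition functions are jointly continuous in the base point and the argument. The limit
points of `Q y v` are identified with the value of `Q` at the limit because dilatations separate
points to first order. -/
theorem exists_convTo (h : EquivalentVia S T P Q) (hρ : 0 < ρ)
    (hQ : IsTransitionNear S T Q x ρ) : ∃ r > 0, r ≤ ρ ∧ ∀ v₀, S.dist v₀ x < r →
      ∀ {ι : Type*} {l : Filter ι} {y v : ι → X}, S.ConvTo l y x → S.ConvTo l v v₀ →
        T.ConvTo l (fun i => Q (y i) (v i)) (Q x v₀) := by
  obtain ⟨K, hK, hd⟩ := h.exists_dist_le
  obtain ⟨κ₀, hκ₀, hκ₁, hnear⟩ := T.exists_dist_le_of_dist_δ_lt x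
  obtain ⟨κ, hκ, hκ', hκ4⟩ : ∃ κ : ℝ, 0 < κ ∧ κ < κ₀ ∧ κ ≤ 1 / 4 :=
    ⟨min (κ₀ / 2) (1 / 4), by positivity,
      (min_le_left _ _).trans_lt (half_lt_self hκ₀), min_le_right _ _⟩
  obtain ⟨r, hr, hfar⟩ := S.exists_dist_δ_le x (κ := κ / (4 * K)) (by positivity)
  have hS := S.one_lt_A
  have hT := T.one_lt_A
  refine ⟨min (min r ρ) 1, by positivity, (min_le_left _ _).trans (min_le_right _ _), ?_⟩
  intro v₀ hv₀ ι l y v hy hv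
  rw [lt_min_iff, lt_min_iff] at hv₀
  have hyT := h.convTo hy
  have hyρ := hy.eventually_lt hρ
  have hvr : ∀ᶠ i in l, S.dist (v i) x < r :=
    (hv.dist (convTo_const x)).eventually_lt_const hv₀.1.1
  have hvρ : ∀ᶠ i in l, S.dist (v i) x < ρ :=
    (hv.dist (convTo_const x)).eventually_lt_const hv₀.1.2
  have hbd : ∀ᶠ i in l, T.dist (Q (y i) (v i)) x ≤ 1 := by
    obtain ⟨ε, hε, hε0, hε1⟩ := ((hQ.2 (κ / 4) (by positivity)).and
      (Ioo_mem_nhdsGT (lt_min hr one_pos))).exists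
    rw [lt_min_iff] at hε1
    filter_upwards [hyT.eventually_lt (half_pos one_pos), hyρ, hvρ, hy.eventually_lt hr, hvr]
      with i h1 h2 h3 h4 h5
    have h6 := hfar _ _ ε h4 h5 hε0 hε1.1
    have h7 := hε _ _ h2 h3
    have h8 := T.dist_triangle' (T.δ ε (y i) (Q (y i) (v i))) (S.δ ε (y i) (v i)) (y i)
    rw [T.dist_comm'] at h7
    have h9 : T.dist (S.δ ε (y i) (v i)) (y i) ≤ κ / 4 * ε :=
      calc _ ≤ K * S.dist (S.δ ε (y i) (v i)) (y i) := hd _ _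
        _ ≤ K * (κ / (4 * K) * ε) := mul_le_mul_of_nonneg_left h6 hK.le
        _ = κ / 4 * ε := by field_simp
    have h10 := hnear (y i) (Q (y i) (v i)) κ ε (by linarith) hκ hκ' hε0 hε1.2.le
      (hQ.1 _ _ h2 h3).2 (by nlinarith [mul_pos hκ hε0])
    have h11 := T.dist_triangle' (Q (y i) (v i)) (y i) x
    linarith
  refine convTo_of_ultrafilter fun G hG => ?_
  obtain ⟨q, hq, hlim⟩ := T.exists_convTo_of_ultrafilter x G (hbd.filter_mono hG)
  have hpos : ∀ᶠ ε : ℝ in 𝓝[>] 0, 0 < id ε := self_mem_nhdsWithin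
  have hfo : T.FirstOrderEq (𝓝[>] 0) id (fun ε => S.δ ε x v₀) (fun ε => T.δ ε x q) := by
    refine (firstOrderEq_iff hpos).2 fun η hη => ?_
    filter_upwards [hQ.2 η hη, Ioo_mem_nhdsGT (zero_lt_one' ℝ)] with ε hε hε1
    have h1 := h.convTo ((hy.mono hG).δ_const hε1.1 (hv.mono hG)
      (((hy.mono hG).mem_U (hv.mono hG) (by linarith)).mono fun i hi => Or.inl ⟨hε1.2.le, hi⟩)
      (Or.inl ⟨hε1.2.le, S.mem_U (by linarith)⟩))
    have h2 := (hyT.mono hG).δ_const hε1.1 hlim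
      (((hyT.mono hG).mem_U hlim (by linarith)).mono fun i hi => Or.inl ⟨hε1.2.le, hi⟩)
      (Or.inl ⟨hε1.2.le, T.mem_U (by linarith)⟩)
    refine le_of_tendsto (h1.dist h2) ?_
    filter_upwards [hyρ.filter_mono hG, hvρ.filter_mono hG] with i h3 h4 using hε _ _ h3 h4
  have hx : S.dist x x < ρ := by rwa [S.dist_self']
  have heq : Q x v₀ = q := T.eq_of_firstOrderEq (hQ.1 x v₀ hx hv₀.1.2).2 (T.mem_U (by linarith))
    ((hQ.firstOrderEq_const hv₀.1.2 tendsto_id).symm.trans hpos hfo)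
  rwa [heq]

theorem exists_dist_map_lt (h : EquivalentVia S T P Q) (hρ : 0 < ρ)
    (hQ : IsTransitionNear S T Q x ρ) {η : ℝ} (hη : 0 < η) :
    ∃ r > 0, ∀ u, S.dist u x < r → T.dist (Q x u) x < η := by
  obtain ⟨r, hr, -, hc⟩ := hQ.exists_convTo h hρ
  let := S.toMetricSpace
  have h1 := hc x (by rwa [S.dist_self']) (l := 𝓝 x) (convTo_const x)
    (S.convTo_iff_tendsto.2 tendsto_id)
  rw [hQ.map_self hρ] at h1
  exact Metric.eventually_nhds_iff.1 (h1.eventually_lt hη)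

/-- The transition functions are morphisms of local groups. -/
theorem exists_isSum (h : EquivalentVia S T P Q) (hρ : 0 < ρ)
    (hQ : IsTransitionNear S T Q x ρ) : ∃ r > 0, ∀ u v w, S.dist u x < r → S.dist v x < r →
      S.dist w x < r → S.IsSum x u v w → T.IsSum x (Q x u) (Q x v) (Q x w) := by
  obtain ⟨r₁, hr₁, hr₁ρ, hcont⟩ := hQ.exists_convTo h hρ
  obtain ⟨ρ₁, hρ₁, hbase⟩ := T.exists_firstOrderEq_δ_base x
  obtain ⟨ρ₂, hρ₂, hsum⟩ := T.exists_isSum_of_firstOrderEq x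
  obtain ⟨r₂, hr₂, hsmall⟩ := hQ.exists_dist_map_lt h hρ (lt_min hρ₁ hρ₂)
  have hA := S.one_lt_A
  refine ⟨min (min r₁ r₂) 1, by positivity, ?_⟩
  intro u v w hu hv hw hS
  simp only [lt_min_iff] at hu hv hw hsmall
  have hpos : ∀ᶠ ε : ℝ in 𝓝[>] 0, 0 < id ε := self_mem_nhdsWithin
  refine hsum _ _ _ (hsmall u hu.1.2).2 (hsmall v hv.1.2).2 (hsmall w hw.1.2).2 ?_
  have hy : S.ConvTo (𝓝[>] 0) (fun ε => S.δ ε x u) x :=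
    δ_convTo_base tendsto_id (S.mem_U (by linarith))
  have h1 := hbase (Q x v) (hsmall v hv.1.2).1 tendsto_id (h.convTo hy)
    (hQ.firstOrderEq_const (hu.1.1.trans_le hr₁ρ) tendsto_id)
    (hcont v hv.1.1 hy (convTo_const v)) (convTo_const (Q x v))
  have h2 := hQ.firstOrderEq tendsto_id (hy.eventually_lt hρ)
    (Eventually.of_forall fun _ : ℝ => hv.1.1.trans_le hr₁ρ)
  exact (h1.symm.trans hpos h2.symm).trans hpos
    ((h.firstOrderEq hpos (hS.firstOrderEq (by linarith))).trans hpos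
      (hQ.firstOrderEq_const (hw.1.1.trans_le hr₁ρ) tendsto_id))

end IsTransitionNear

/-- Around each point there is a ball on which `Q` has all the properties of a transition function
and is a morphism of local groups. -/
theorem EquivalentVia.exists_near (h : EquivalentVia S T P Q) (x : X) : ∃ ρ > 0,
    IsTransitionNear S T Q x ρ ∧ ∀ u v w, S.dist u x < ρ → S.dist v x < ρ → S.dist w x < ρ →
      S.IsSum x u v w → T.IsSum x (Q x u) (Q x v) (Q x w) := by
  obtain ⟨ρ, hρ, hQ⟩ := h.transition_Q.exists_near x
  obtain ⟨r, hr, hsum⟩ := hQ.exists_isSum h hρ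
  exact ⟨min ρ r, lt_min hρ hr, hQ.mono (min_le_left _ _), fun u v w hu hv hw =>
    hsum u v w (hu.trans_le (min_le_right _ _)) (hv.trans_le (min_le_right _ _))
      (hw.trans_le (min_le_right _ _))⟩

end Equivalence

/-! ### Horizontal points -/

section Horizontal

variable {S T : StrongDilatationStructure X} {P Q : X → X → X} {x : X} {ρ : ℝ}

theorem IsTransitionNear.map_mem_horizontal (hQ : IsTransitionNear S T Q x ρ)
    (hsum : ∀ u v w, S.dist u x < ρ → S.dist v x < ρ → S.dist w x < ρ →
      S.IsSum x u v w → T.IsSum x (Q x u) (Q x v) (Q x w)) {u : X} (hu : S.dist u x < ρ)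
    (h : u ∈ S.horizontal x) : Q x u ∈ T.horizontal x := by
  obtain ⟨huU, h⟩ := h
  have hρ : 0 < ρ := (S.dist_nonneg' u x).trans_lt hu
  refine ⟨(hQ.1 x u (by rwa [S.dist_self']) hu).2, fun a b ha hb => ?_⟩
  have key : ∀ c : ℝ, 0 < c → ∀ᶠ s : ℝ in 𝓝[>] 0, S.dist (S.δ (s * c) x u) x < ρ ∧
      Q x (S.δ (s * c) x u) = T.δ (s * c) x (Q x u) := by
    intro c hc
    have hm : Tendsto (fun s : ℝ => s * c) (𝓝[>] 0) (𝓝[>] 0) := by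
      refine tendsto_nhdsWithin_iff.2 ⟨?_, ?_⟩
      · exact ((continuous_mul_const c).tendsto' 0 0 (zero_mul c)).mono_left nhdsWithin_le_nhds
      · filter_upwards [self_mem_nhdsWithin] with ε hε using mul_pos hε hc
    filter_upwards [(δ_convTo_base hm huU).eventually_lt hρ,
      hm.eventually (Ioo_mem_nhdsGT (zero_lt_one' ℝ))] with s h1 h2
    exact ⟨h1, hQ.map_δ hu h2.1 h2.2.le h1⟩
  filter_upwards [h a b ha hb, key a ha, key b hb, key (a + b) (add_pos ha hb)]
    with s h1 h2 h3 h4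
  rw [← h2.2, ← h3.2, ← h4.2]
  exact hsum _ _ _ h2.1 h3.1 h4.1 h1

theorem EquivalentVia.exists_image_horizontal (h : EquivalentVia S T P Q) (x : X) :
    ∃ r > 0, ∀ N : Set X,
      N ∈ @nhds X S.toUniformSpace.toTopologicalSpace x → (∀ u ∈ N, S.dist x u < r) →
        Q x '' N ∈ @nhds X T.toUniformSpace.toTopologicalSpace x ∧
        Q x '' (S.horizontal x ∩ N) = T.horizontal x ∩ Q x '' N := by
  obtain ⟨ρ, hρ, hQ, hsum⟩ := h.exists_near x
  obtain ⟨ρ', hρ', hP, hsum'⟩ := h.symm.exists_near x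
  obtain ⟨r, hr, hsmall⟩ := hQ.exists_dist_map_lt h hρ hρ'
  refine ⟨min ρ r, lt_min hρ hr, fun N hN hNr => ⟨?_, ?_⟩⟩
  · obtain ⟨s, hs, hsN⟩ := S.mem_nhds_iff'.1 hN
    obtain ⟨r', hr', hsmall'⟩ := hP.exists_dist_map_lt h.symm hρ' (lt_min hs hρ)
    refine T.mem_nhds_iff'.2 ⟨min r' ρ', lt_min hr' hρ', fun v hv => ?_⟩
    rw [lt_min_iff] at hv
    have hv' := lt_min_iff.1 (hsmall' v hv.1)
    exact ⟨P x v, hsN _ hv'.1, hP.map_map h.symm hQ hv.2 hv'.2⟩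
  · have hN' : ∀ u ∈ N, S.dist u x < ρ ∧ S.dist u x < r := by
      intro u hu
      rw [S.dist_comm']
      exact lt_min_iff.1 (hNr u hu)
    refine subset_antisymm ?_ ?_
    · rintro _ ⟨u, ⟨hu, huN⟩, rfl⟩
      exact ⟨hQ.map_mem_horizontal hsum (hN' u huN).1 hu, u, huN, rfl⟩
    · rintro _ ⟨hu, u, huN, rfl⟩
      have h1 := hsmall u (hN' u huN).2
      have h2 := hP.map_mem_horizontal hsum' h1 hu
      rw [hQ.map_map h hP (hN' u huN).1 h1] at h2
      exact ⟨u, ⟨h2, huN⟩, rfl⟩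

end Horizontal

end StrongDilatationStructure

/-! ### Arc length and first order domination -/

section Variation

open MeasureTheory

/-- A Lipschitz real function whose increments are dominated to first order, at almost every point
and along some positive direction, by those of a Lipschitz curve `f` has total increment at most
the length of `f`: its derivative is dominated almost everywhere by that of the arc length. -/
theorem sub_le_eVariationOn_toReal {E : Type*} [PseudoMetricSpace E] {f : ℝ → E} {g : ℝ → ℝ}
    {a b : ℝ} {C D : NNReal} (hab : a ≤ b) (hf : LipschitzOnWith C f (Icc a b))
    (hg : LipschitzOnWith D g (Icc a b))
    (h : ∀ᵐ t : ℝ, t ∈ Ioo a b → ∃ k > 0, ∀ η > 0, ∀ᶠ ε : ℝ in 𝓝[>] 0,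
      g (t + ε * k) - g t ≤ dist (f (t + ε * k)) (f t) + η * ε) :
    g b - g a ≤ (eVariationOn f (Icc a b)).toReal := by
  have hBV := hf.locallyBoundedVariationOn
  have ha : a ∈ Icc a b := left_mem_Icc.2 hab
  have hb : b ∈ Icc a b := right_mem_Icc.2 hab
  set V := variationOnFromTo f (Icc a b) a with hV
  have hmono : MonotoneOn V (Icc a b) := variationOnFromTo.monotoneOn hBV ha
  have hVab : V b - V a = (eVariationOn f (Icc a b)).toReal := by
    rw [hV, variationOnFromTo.self, variationOnFromTo.eq_of_le _ _ hab, inter_self, sub_zero]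
  rw [← uIcc_of_le hab] at hg
  have hac := hg.absolutelyContinuousOnInterval
  have hmono' : MonotoneOn V (uIcc a b) := by rwa [uIcc_of_le hab]
  rw [← hVab, ← hac.integral_deriv_eq_sub]
  have hVint : ∫ t in a..b, deriv V t ≤ V b - V a := by
    have h1 := hmono'.intervalIntegral_deriv_mem_uIcc
    rw [uIcc_of_le (sub_nonneg.2 (hmono ha hb hab))] at h1
    exact h1.2
  refine le_trans (intervalIntegral.integral_mono_ae_restrict hab hac.intervalIntegrable_deriv
    hmono'.intervalIntegrable_deriv ?_) hVint
  rw [EventuallyLE, ← restrict_Ioo_eq_restrict_Icc, ae_restrict_iff' measurableSet_Ioo]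
  filter_upwards [h, hmono.ae_differentiableWithinAt_of_mem, hac.ae_differentiableAt]
    with t h1 h2 h3 ht
  obtain ⟨k, hk, h1⟩ := h1 ht
  have htI : t ∈ Icc a b := Ioo_subset_Icc_self ht
  have hVd := ((h2 htI).differentiableAt (Icc_mem_nhds ht.1 ht.2)).hasDerivAt
  have hgd := (h3 (by rwa [uIcc_of_le hab])).hasDerivAt
  have hline : HasDerivAt (fun ε : ℝ => t + ε * k) k 0 := by
    simpa using ((hasDerivAt_id (0 : ℝ)).mul_const k).const_add t
  have hslope : ∀ {F : ℝ → ℝ} {F' : ℝ}, HasDerivAt F F' t →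
      Tendsto (fun ε : ℝ => (F (t + ε * k) - F t) / ε) (𝓝[>] 0) (𝓝 (F' * k)) := by
    intro F F' hF
    have h4 : HasDerivAt (fun ε : ℝ => F (t + ε * k)) (F' * k) 0 :=
      HasDerivAt.comp (0 : ℝ) (h₂ := F) (by simpa using hF) hline
    refine ((hasDerivAt_iff_tendsto_slope.1 h4).mono_left
      (nhdsWithin_mono _ fun ε (hε : 0 < ε) => hε.ne')).congr fun ε => ?_
    simp [slope_def_field]
  have hin : ∀ᶠ ε : ℝ in 𝓝[>] 0, t + ε * k ∈ Icc a b := by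
    have : Tendsto (fun ε : ℝ => t + ε * k) (𝓝[>] 0) (𝓝 t) := by
      simpa using hline.continuousAt.tendsto.mono_left nhdsWithin_le_nhds
    exact this.eventually (Icc_mem_nhds ht.1 ht.2)
  have hle : deriv g t * k ≤ deriv V t * k := by
    refine le_of_forall_pos_le_add fun η hη => ?_
    refine le_of_tendsto_of_tendsto (hslope hgd) ((hslope hVd).add_const η) ?_
    filter_upwards [hin, h1 η hη, self_mem_nhdsWithin] with ε h4 h5 (h6 : 0 < ε)
    have h7 : t ≤ t + ε * k := by nlinarith
    have h8 : dist (f (t + ε * k)) (f t) ≤ V (t + ε * k) - V t := by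
      rw [hV, variationOnFromTo.sub_right hBV ha h4 htI, variationOnFromTo.eq_of_le _ _ h7,
        dist_edist]
      exact ENNReal.toReal_mono (hBV t _ htI h4) (eVariationOn.edist_le f
        ⟨h4, h7, le_rfl⟩ ⟨htI, le_rfl, h7⟩)
    rw [div_add' _ _ _ h6.ne', div_le_div_iff_of_pos_right h6]
    linarith
  exact le_of_mul_le_mul_right hle hk

end Variation

namespace StrongDilatationStructure

variable {X : Type*} {S T : StrongDilatationStructure X} {P Q : X → X → X}

/-! ### Derivability and lengths of curves -/

theorem EquivalentVia.lipschitzOnWith (h : EquivalentVia S T P Q) {c : ℝ → X} {C : NNReal}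
    {s : Set ℝ} (hc : @LipschitzOnWith ℝ X _ S.toPseudoEMetricSpace C c s) :
    ∃ D, @LipschitzOnWith ℝ X _ T.toPseudoEMetricSpace D c s := by
  obtain ⟨K, hK, hd⟩ := h.exists_dist_le
  have hc' := (@lipschitzOnWith_iff_dist_le_mul ℝ X _ S.toPseudoMetricSpace _ _ _).1 hc
  refine ⟨⟨K, hK.le⟩ * C,
    (@lipschitzOnWith_iff_dist_le_mul ℝ X _ T.toPseudoMetricSpace _ _ _).2 fun y hy z hz => ?_⟩
  have h1 := mul_le_mul_of_nonneg_left (hc' y hy z hz) hK.le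
  rw [← mul_assoc] at h1
  exact (hd _ _).trans h1

/-- A conical morphism from a neighbourhood of zero in `ℝ` is continuous at zero. -/
theorem exists_dist_morphism_lt {x : X} {r : ℝ} (hr : 0 < r) {f : ℝ → X}
    (hU : ∀ h : ℝ, |h| < r → f h ∈ S.U x)
    (hf : ∀ l h : ℝ, 0 < l → |h| < r → |l * h| < r →
      f h ∈ S.dom l x ∧ S.δ l x (f h) = f (l * h)) {ρ : ℝ} (hρ : 0 < ρ) :
    ∃ r' > 0, r' ≤ r ∧ ∀ h : ℝ, |h| < r' → S.dist (f h) x < ρ := by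
  have h0 : |(0 : ℝ)| < r := by simpa using hr
  have hp : |r / 2| < r := by rw [abs_of_pos (half_pos hr)]; linarith
  have hn : |-(r / 2)| < r := by rwa [abs_neg]
  have key : ∀ h : ℝ, |h| < r → ∀ᶠ l : ℝ in 𝓝[>] 0, S.dist (S.δ l x (f h)) x < ρ :=
    fun h hh => (δ_convTo_base tendsto_id (hU h hh)).eventually_lt hρ
  obtain ⟨l₀, hl₀, hl⟩ := mem_nhdsGT_iff_exists_Ioo_subset.1
    ((key 0 h0).and ((key _ hp).and (key _ hn)))
  have hl₀' : 0 < l₀ := hl₀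
  refine ⟨min r (l₀ * (r / 2)), lt_min hr (mul_pos hl₀' (half_pos hr)), min_le_left _ _,
    fun h hh => ?_⟩
  rw [lt_min_iff] at hh
  rcases eq_or_ne h 0 with rfl | hne
  · have h1 := (hl ⟨half_pos hl₀', half_lt_self hl₀'⟩).1
    rwa [(hf (l₀ / 2) 0 (half_pos hl₀') h0 (by simpa using hr)).2, mul_zero] at h1
  · have habs : 0 < |h| := abs_pos.2 hne
    have hlt : |h| / (r / 2) < l₀ := (div_lt_iff₀ (half_pos hr)).2 hh.2
    have hpos : 0 < |h| / (r / 2) := div_pos habs (half_pos hr)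
    have h1 := (hl ⟨hpos, hlt⟩).2
    have hr2 : r / 2 ≠ 0 := (half_pos hr).ne'
    rcases abs_choice h with habs' | habs'
    · have h2 : |h| / (r / 2) * (r / 2) = h := by rw [div_mul_cancel₀ _ hr2, habs']
      have h3 := (hf _ _ hpos hp (by rw [h2]; exact hh.1)).2
      rw [h2] at h3
      rw [← h3]
      exact h1.1
    · have h2 : |h| / (r / 2) * -(r / 2) = h := by
        rw [mul_neg, div_mul_cancel₀ _ hr2, habs', neg_neg]
      have h3 := (hf _ _ hpos hn (by rw [h2]; exact hh.1)).2
      rw [h2] at h3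
      rw [← h3]
      exact h1.2

/-- If `f` is the derivative of `c` at `t` for `S`, then `Q ∘ f` is its derivative for `T`. -/
theorem EquivalentVia.derivableAt (h : EquivalentVia S T P Q) {c : ℝ → X} {t : ℝ}
    (hc : S.DerivableAt c t) : T.DerivableAt c t := by
  obtain ⟨ρ, hρ, hQ, hsum⟩ := h.exists_near (c t)
  obtain ⟨K, hK, hd⟩ := h.exists_dist_le
  obtain ⟨r, hr, f, hU, hadd, hmul, hlim⟩ := hc
  obtain ⟨r', hr', hr'r, hsmall⟩ := exists_dist_morphism_lt hr hU hmul hρ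
  have hx : S.dist (c t) (c t) < ρ := by rwa [S.dist_self']
  have hQU : ∀ k : ℝ, |k| < r' → Q (c t) (f k) ∈ T.U (c t) := fun k hk =>
    (hQ.1 _ _ hx (hsmall k hk)).2
  have hle : ∀ l k : ℝ, 0 < l → l ≤ 1 → |k| < r' → |l * k| < r' →
      T.δ l (c t) (Q (c t) (f k)) = Q (c t) (f (l * k)) := by
    intro l k hl hl1 hk hlk
    have h1 := (hmul l k hl (hk.trans_le hr'r) (hlk.trans_le hr'r)).2
    have h2 := hsmall _ hlk
    rw [← h1] at h2 ⊢
    exact (hQ.map_δ (hsmall k hk) hl hl1 h2).symm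
  refine ⟨r', hr', fun k => Q (c t) (f k), hQU, ?_, ?_, ?_⟩
  · intro k m hk hm hkm
    exact hsum _ _ _ (hsmall _ hk) (hsmall _ hm) (hsmall _ hkm)
      (hadd k m (hk.trans_le hr'r) (hm.trans_le hr'r) (hkm.trans_le hr'r))
  · intro l k hl hk hlk
    rcases le_or_gt l 1 with hl1 | hl1
    · exact ⟨Or.inl ⟨hl1, hQU k hk⟩, hle l k hl hl1 hk hlk⟩
    · -- For `l > 1` the dilatation is the inverse of the one of coefficient `l⁻¹`.
      have hk' : l⁻¹ * (l * k) = k := inv_mul_cancel_left₀ hl.ne' k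
      have h1 := hle l⁻¹ (l * k) (inv_pos.2 hl) (inv_le_one_of_one_le₀ hl1.le) hlk
        (by rwa [hk'])
      rw [hk'] at h1
      have h2 := T.δ_inv_δ (hQU _ hlk) (inv_pos.2 hl) (inv_le_one_of_one_le₀ hl1.le)
      rwa [h1, inv_inv] at h2
  · intro η hη
    filter_upwards [hlim (η / (2 * K)) (by positivity), hQ.2 (η / 2) (half_pos hη),
      self_mem_nhdsWithin] with ε h1 h2 (hε : 0 < ε) k hk
    have h3 := h1 k (hk.trans_le hr'r)
    have h4 := h2 _ _ hx (hsmall k hk)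
    rw [div_le_iff₀ hε] at h3 ⊢
    have h5 : T.dist (c (t + ε * k)) (S.δ ε (c t) (f k)) ≤ η / 2 * ε :=
      calc _ ≤ K * S.dist (c (t + ε * k)) (S.δ ε (c t) (f k)) := hd _ _
        _ ≤ K * (η / (2 * K) * ε) := mul_le_mul_of_nonneg_left h3 hK.le
        _ = η / 2 * ε := by field_simp
    have h6 := T.dist_triangle' (c (t + ε * k)) (S.δ ε (c t) (f k))
      (T.δ ε (c t) (Q (c t) (f k)))
    linarith

theorem EquivalentVia.radonNikodym (h : EquivalentVia S T P Q) (hS : S.RadonNikodym) :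
    T.RadonNikodym := by
  intro a b c C hab hc
  obtain ⟨D, hD⟩ := h.symm.lipschitzOnWith hc
  filter_upwards [hS a b c D hab hD] with t ht ht' using h.derivableAt (ht ht')

theorem FirstOrderEq.tendsto_dist {ι : Type*} {l : Filter ι} {e : ι → ℝ} {p q : ι → X} {x : X}
    {L : ℝ} (he : ∀ᶠ i in l, 0 < e i) (h : S.FirstOrderEq l e p q)
    (hq : Tendsto (fun i => S.dist (q i) x / e i) l (𝓝 L)) :
    Tendsto (fun i => S.dist (p i) x / e i) l (𝓝 L) := by
  have h1 := hq.sub h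
  have h2 := hq.add h
  rw [sub_zero] at h1
  rw [add_zero] at h2
  refine tendsto_of_tendsto_of_tendsto_of_le_of_le' h1 h2 ?_ ?_
  · filter_upwards [he] with i hi
    rw [← sub_div]
    refine div_le_div_of_nonneg_right ?_ hi.le
    have := S.dist_triangle' (q i) (p i) x
    rw [S.dist_comm' (q i) (p i)] at this
    linarith
  · filter_upwards [he] with i hi
    rw [← add_div]
    refine div_le_div_of_nonneg_right ?_ hi.le
    have := S.dist_triangle' (p i) (q i) x
    linarith

/-- The two metric speeds of a curve agree at a point where it is derivable: both are the tangent
norm of the derivative. -/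
theorem EquivalentVia.tendsto_dist_sub_dist (h : EquivalentVia S T P Q)
    (hQ : TangentIsometry S T Q) {c : ℝ → X} {t : ℝ} (hc : S.DerivableAt c t) :
    ∃ k > 0, Tendsto (fun ε => S.dist (c (t + ε * k)) (c t) / ε - T.dist (c (t + ε * k)) (c t) / ε)
      (𝓝[>] 0) (𝓝 0) := by
  obtain ⟨ρ, hρ, hnear⟩ := h.transition_Q.exists_near (c t)
  obtain ⟨r, hr, f, hU, -, hmul, hlim⟩ := hc
  obtain ⟨r₁, hr₁, hiso⟩ := hQ (c t)
  have hSA := S.one_lt_A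
  have hTA := T.one_lt_A
  obtain ⟨r₂, hr₂, hsmallQ⟩ := hnear.exists_dist_map_lt h hρ one_pos
  obtain ⟨r', hr', hr'r, hsmall⟩ := exists_dist_morphism_lt hr hU hmul
    (lt_min (lt_min hρ hr₁) (lt_min hr₂ one_pos))
  have hk : |r' / 2| < r' := by rw [abs_of_pos (half_pos hr')]; linarith
  have hu := hsmall _ hk
  set u := f (r' / 2)
  simp only [lt_min_iff] at hu
  have hpos : ∀ᶠ ε : ℝ in 𝓝[>] 0, 0 < id ε := self_mem_nhdsWithin
  refine ⟨r' / 2, half_pos hr', ?_⟩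
  have hxS : S.dist (c t) (c t) ≤ S.A := by rw [S.dist_self']; linarith
  have hxT : T.dist (c t) (c t) ≤ T.A := by rw [T.dist_self']; linarith
  have hS1 := S.tendsto_rescaled_dist (c t) (u := u) (by linarith) hxS
  have hT1 := T.tendsto_rescaled_dist (c t) (u := Q (c t) u) (by linarith [hsmallQ u hu.2.1]) hxT
  have htan := hiso u (c t) (by rw [S.dist_comm']; exact hu.1.2.le)
    (by rw [S.dist_self']; exact hr₁.le)
  rw [hnear.map_self hρ] at htan
  rw [htan] at hT1
  have hSf : S.FirstOrderEq (𝓝[>] 0) id (fun ε => c (t + ε * (r' / 2)))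
      (fun ε => S.δ ε (c t) u) := by
    refine (firstOrderEq_iff hpos).2 fun η hη => ?_
    filter_upwards [hlim η hη, hpos] with ε h1 h2
    exact (div_le_iff₀ h2).1 (h1 _ (hk.trans_le hr'r))
  have hTf := (h.firstOrderEq hpos hSf).trans hpos
    (hnear.firstOrderEq_const hu.1.1 tendsto_id)
  have hS2 := hSf.tendsto_dist hpos (hS1.congr' (by
    filter_upwards [self_mem_nhdsWithin] with ε (hε : 0 < ε)
    rw [S.δ_self _ _ hε, id]))
  have hT2 := hTf.tendsto_dist hpos (hT1.congr' (by
    filter_upwards [self_mem_nhdsWithin] with ε (hε : 0 < ε)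
    rw [T.δ_self _ _ hε]
    rfl))
  have h3 := hS2.sub hT2
  rwa [sub_self] at h3

/-- A Lipschitz curve is not longer for `S` than for `T`. -/
theorem EquivalentVia.eVariationOn_le (h : EquivalentVia S T P Q) (hQ : TangentIsometry S T Q)
    (hS : S.RadonNikodym) {c : ℝ → X} {C : NNReal} {a b : ℝ}
    (hc : @LipschitzOnWith ℝ X _ S.toPseudoEMetricSpace C c (Icc a b)) :
    @eVariationOn ℝ _ X S.toPseudoEMetricSpace c (Icc a b) ≤
      @eVariationOn ℝ _ X T.toPseudoEMetricSpace c (Icc a b) := by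
  obtain ⟨D, hD⟩ := h.lipschitzOnWith hc
  have key : ∀ s t, a ≤ s → s ≤ t → t ≤ b → S.edist (c t) (c s) ≤
      @eVariationOn ℝ _ X T.toPseudoEMetricSpace c (Icc s t) := by
    intro s t has hst htb
    have hsub : Icc s t ⊆ Icc a b := Icc_subset_Icc has htb
    rcases hst.eq_or_lt with rfl | hlt
    · rw [S.edist_eq_ofReal, S.dist_self', ENNReal.ofReal_zero]
      exact zero_le
    have hcS : @LipschitzOnWith ℝ X _ S.toPseudoEMetricSpace C c (Icc s t) :=
      fun y hy z hz => hc (hsub hy) (hsub hz)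
    have hg : LipschitzOnWith C (fun τ => S.dist (c τ) (c s)) (Icc s t) := by
      let := S.toMetricSpace
      refine LipschitzOnWith.of_dist_le_mul fun y hy z hz => ?_
      rw [Real.dist_eq]
      exact (abs_dist_sub_le (c y) (c z) (c s)).trans (hcS.dist_le_mul y hy z hz)
    have hae : ∀ᵐ τ : ℝ, τ ∈ Ioo s t → ∃ k > 0, ∀ η > 0, ∀ᶠ ε : ℝ in 𝓝[>] 0,
        S.dist (c (τ + ε * k)) (c s) - S.dist (c τ) (c s) ≤
          T.dist (c (τ + ε * k)) (c τ) + η * ε := by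
      filter_upwards [hS s t c C hlt hcS] with τ h1 h2
      obtain ⟨k, hk, hlim⟩ := h.tendsto_dist_sub_dist hQ (h1 h2)
      refine ⟨k, hk, fun η hη => ?_⟩
      filter_upwards [hlim.eventually_lt_const hη, self_mem_nhdsWithin] with ε h3 (hε : 0 < ε)
      rw [← sub_div, div_lt_iff₀ hε] at h3
      have := S.dist_triangle' (c (τ + ε * k)) (c τ) (c s)
      linarith
    have h1 := @sub_le_eVariationOn_toReal X T.toPseudoMetricSpace c
      (fun τ => S.dist (c τ) (c s)) s t D C hst (fun y hy z hz => hD (hsub hy) (hsub hz)) hg hae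
    simp only [S.dist_self', sub_zero] at h1
    rw [S.edist_eq_ofReal]
    exact ENNReal.ofReal_le_of_le_toReal h1
  refine iSup_le ?_
  rintro ⟨n, u, hu, hus⟩
  calc ∑ i ∈ Finset.range n, S.edist (c (u (i + 1))) (c (u i))
      ≤ ∑ i ∈ Finset.range n,
          @eVariationOn ℝ _ X T.toPseudoEMetricSpace c (Icc (u i) (u (i + 1))) :=
        Finset.sum_le_sum fun i _ => key _ _ (hus i).1 (hu i.le_succ) (hus (i + 1)).2
    _ = @eVariationOn ℝ _ X T.toPseudoEMetricSpace c (Icc (u 0) (u n)) :=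
        @eVariationOn.sum' ℝ _ X T.toPseudoEMetricSpace c u hu n
    _ ≤ _ := @eVariationOn.mono ℝ _ X T.toPseudoEMetricSpace c _ _
        (Icc_subset_Icc (hus 0).1 (hus n).2)

theorem EquivalentVia.dist_le_dist (h : EquivalentVia S T P Q) (hQ : TangentIsometry S T Q)
    (hS : S.RadonNikodym) (hSL : S.IsLengthSpace) (hTL : T.IsLengthSpace) (x y : X) :
    S.dist x y ≤ T.dist x y := by
  have h1 : S.edist x y ≤ T.edist x y := by
    refine (hTL x y).2 ?_
    rintro _ ⟨a, b, c, C, hab, hc, rfl, rfl, rfl⟩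
    obtain ⟨D, hD⟩ := h.symm.lipschitzOnWith hc
    exact ((hSL _ _).1 ⟨a, b, c, D, hab, hD, rfl, rfl, rfl⟩).trans (h.eVariationOn_le hQ hS hD)
  rw [S.edist_eq_ofReal, T.edist_eq_ofReal] at h1
  exact (ENNReal.ofReal_le_ofReal_iff (T.dist_nonneg' x y)).1 h1

end StrongDilatationStructure

theorem corollary40 {X : Type*} (S T : StrongDilatationStructure X) (P Q : X → X → X)
    (h : StrongDilatationStructure.EquivalentVia S T P Q) :
    (∀ x : X, ∃ r > 0, ∀ N : Set X,
      N ∈ @nhds X S.toUniformSpace.toTopologicalSpace x → (∀ u ∈ N, S.dist x u < r) →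
        Q x '' N ∈ @nhds X T.toUniformSpace.toTopologicalSpace x ∧
        Q x '' (S.horizontal x ∩ N) = T.horizontal x ∩ Q x '' N) ∧
    (S.RadonNikodym → T.RadonNikodym) ∧
    (S.IsLengthSpace → T.IsLengthSpace → S.RadonNikodym → T.RadonNikodym →
      StrongDilatationStructure.TangentIsometry S T Q →
      StrongDilatationStructure.TangentIsometry T S P →
      ∀ x y : X, S.dist x y = T.dist x y) :=
  ⟨h.exists_image_horizontal, h.radonNikodym, fun hSL hTL hS hT hQ hP x y =>
    le_antisymm (h.dist_le_dist hQ hS hSL hTL x y) (h.symm.dist_le_dist hP hT hTL hSL x y)⟩
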